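/- Let $E$ be a directed graph with finite vertex set $E^0$, (arbitrary) edge set $E^1$, and source and range maps $s,r:E^1\to E^0$. A vertex $v$ is *regular* if $s^{-1}(v)$ is nonempty and finite; let $V$ be a set of regular vertices. For an associative unital ring $R$, the *relative Leavitt path ring* $L^V_R(E)$ is the unital $R$-ring generated by the vertices, the edges $e\in E^1$ and the ghost edges $e^\ast$ ($e\in E^1$), all of which commute with the elements of $R$, subject to the relations $$vw=\delta_{v,w}v,\qquad s(e)e=e=e\,r(e),\qquad r(e)e^\ast=e^\ast=e^\ast s(e),\qquad e^\ast f=\delta_{e,f}\,r(e),\qquad \sum_{v\in E^0}v=1$$ for $v,w\in E^0$ and $e,f\in E^1$, together with $\sum_{e\in s^{-1}(v)}ee^\ast=v$ for $v\in V$. For $X\subseteq E^0$, let $E_X$ be the graph with vertex set $X$ and edge set $\{e\in E^1: s(e)\in X,\ r(e)\in X\}$. The set $X$ is *hereditary* if it contains every vertex reachable by a path from a vertex of $X$; it is *$V$-saturated* if every $v\in V$ with $r(s^{-1}(v))\subseteq X$ lies in $X$; and the *$V$-saturated closure* of $X$ is the smallest $V$-saturated set containing $X$. The *generating number* $\mathrm{gn}(S)$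 of a unital ring $S$ is the smallest positive integer $n$ such that there is an epimorphism of right $S$-modules $S^n\to S^{n+1}$, and it is infinite if there is no such $n$. **Proposition 4.3.** Let $X\subseteq E^0$ be hereditary with $V$-saturated closure equal to $E^0$, and let $R$ be any unital ring. (i) The rings $L^{V\cap X}_R(E_X)$ and $L^V_R(E)$ are Morita equivalent. In fact, the idempotent $\epsilon=\sum_{x\in X}x$ of $L=L^V_R(E)$ is full, that is, $L\epsilon L=L$, and there is a ring isomorphism $L^{V\cap X}_R(E_X)\to\epsilon L\epsilon$ that sends each vertex, edge and ghost edge of $E_X$ to the element of $L$ of the same name and sends $c\cdot 1$ to $c\,\epsilon$ for all $c\in R$. (ii) $\mathrm{gn}(L^V_R(E))\le \mathrm{gn}(L^{V\cap X}_R(E_X))$, with equality if at least one of the two generating numbers is infinite. -/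

import Mathlib

universe u v w

namespace LeavittPath

/-- A directed graph with vertex set `E₀` and edge set `E₁` (loops and multiple edges allowed),
given by its source and range functions. -/
structure DirectedGraph (E₀ : Type v) (E₁ : Type w) where
  /-- the source function `s` -/
  src : E₁ → E₀
  /-- the range function `r` -/
  rng : E₁ → E₀

namespace DirectedGraph

variable {E₀ : Type v} {E₁ : Type w} (E : DirectedGraph E₀ E₁)

/-- The set `s⁻¹(a)` of edges emanating from the vertex `a`. -/
def out (a : E₀) : Set E₁ := {e | E.src e = a}

/-- A vertex is regular if it emits at least one edge, but only finitely many. -/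
def IsRegular (a : E₀) : Prop := (E.out a).Nonempty ∧ (E.out a).Finite

/-- The set `Reg(E)` of regular vertices. -/
def Reg : Set E₀ := {a | E.IsRegular a}

/-- `E.IsPath a p b`: the list of edges `p` is a path from `a` to `b`. The empty list is the path
of length `0` at a vertex. -/
def IsPath : E₀ → List E₁ → E₀ → Prop
  | a, [], b => a = b
  | a, e :: p, b => E.src e = a ∧ IsPath (E.rng e) p b

/-- A set of vertices is hereditary if it contains every vertex that can be reached by a path
starting in the set. -/
def IsHereditary (X : Set E₀) : Prop :=
  ∀ x ∈ X, ∀ a : E₀, (∃ p : List E₁, E.IsPath x p a) → a ∈ X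

/-- `X` is `V`-saturated: every `a ∈ V` all of whose emitted edges end in `X` lies in `X`. -/
def IsSaturated (V X : Set E₀) : Prop :=
  ∀ a ∈ V, E.rng '' E.out a ⊆ X → a ∈ X

/-- The `V`-saturated closure of `X`: the smallest `V`-saturated set containing `X`. -/
def saturatedClosure (V X : Set E₀) : Set E₀ :=
  ⋂₀ {Y | X ⊆ Y ∧ E.IsSaturated V Y}

/-- The restriction `E_X` of `E` to a set `X` of vertices. -/
def restrict (X : Set E₀) :
    DirectedGraph X {e : E₁ // E.src e ∈ X ∧ E.rng e ∈ X} where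
  src e := ⟨E.src e.1, e.2.1⟩
  rng e := ⟨E.rng e.1, e.2.2⟩

end DirectedGraph

/-- The generators of a relative Leavitt path ring: vertices, edges and ghost edges. -/
inductive Gen (E₀ : Type v) (E₁ : Type w) : Type (max v w)
  | vertex (a : E₀) : Gen E₀ E₁
  | edge (e : E₁) : Gen E₀ E₁
  | ghost (e : E₁) : Gen E₀ E₁

/-- The free `R`-ring on the vertices, edges and ghost edges, each of which commutes with the
coefficients in `R`: the ring of `R`-linear combinations of words in the generators, where `R` is
an arbitrary, possibly noncommutative, ring. -/
abbrev WordRing (R : Type u) [Ring R] (E₀ : Type v) (E₁ : Type w) : Type (max u v w) :=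
  MonoidAlgebra R (FreeMonoid (Gen E₀ E₁))

/-- A generator, as an element of the free `R`-ring. -/
noncomputable def WordRing.gen (R : Type u) [Ring R] {E₀ : Type v} {E₁ : Type w}
    (g : Gen E₀ E₁) : WordRing R E₀ E₁ :=
  MonoidAlgebra.single (FreeMonoid.of g) 1

open WordRing Gen in
/-- The defining relations of the relative Leavitt path ring of `E` over `R` with respect to `V`.
The last relation is imposed at the vertices in `V` that emit finitely many edges; these are all
vertices in `V` when `V ⊆ Reg(E)`. -/
inductive Rel (R : Type u) [Ring R] {E₀ : Type v} {E₁ : Type w} (E : DirectedGraph E₀ E₁)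
    (V : Set E₀) : WordRing R E₀ E₁ → WordRing R E₀ E₁ → Prop
  | vertex_mul_self (a : E₀) : Rel R E V (gen R (vertex a) * gen R (vertex a)) (gen R (vertex a))
  | vertex_mul_of_ne (a b : E₀) (h : a ≠ b) : Rel R E V (gen R (vertex a) * gen R (vertex b)) 0
  | src_mul_edge (e : E₁) :
      Rel R E V (gen R (vertex (E.src e)) * gen R (edge e)) (gen R (edge e))
  | edge_mul_rng (e : E₁) :
      Rel R E V (gen R (edge e) * gen R (vertex (E.rng e))) (gen R (edge e))
  | sum_vertex : Rel R E V (∑ᶠ a : E₀, gen R (vertex a)) 1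
  | rng_mul_ghost (e : E₁) :
      Rel R E V (gen R (vertex (E.rng e)) * gen R (ghost e)) (gen R (ghost e))
  | ghost_mul_src (e : E₁) :
      Rel R E V (gen R (ghost e) * gen R (vertex (E.src e))) (gen R (ghost e))
  | ghost_mul_edge (e : E₁) :
      Rel R E V (gen R (ghost e) * gen R (edge e)) (gen R (vertex (E.rng e)))
  | ghost_mul_edge_of_ne (e f : E₁) (h : e ≠ f) :
      Rel R E V (gen R (ghost e) * gen R (edge f)) 0
  | sum_edge_mul_ghost (a : E₀) (ha : a ∈ V) (hfin : (E.out a).Finite) :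
      Rel R E V (∑ e ∈ hfin.toFinset, gen R (edge e) * gen R (ghost e)) (gen R (vertex a))

/-- The relative Leavitt path ring `L^V_R(E)` of a directed graph `E` (with finitely many
vertices) over a ring `R` with respect to a set `V` of regular vertices: the quotient of the free
`R`-ring on the generators by the congruence generated by the defining relations. -/
def RelLeavittPathRing (R : Type u) [Ring R] {E₀ : Type v} {E₁ : Type w}
    (E : DirectedGraph E₀ E₁) (V : Set E₀) : Type (max u v w) :=
  RingQuot (Rel R E V)

namespace RelLeavittPathRing

variable (R : Type u) [Ring R] {E₀ : Type v} {E₁ : Type w} (E : DirectedGraph E₀ E₁) (V : Set E₀)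

noncomputable instance : Ring (RelLeavittPathRing R E V) :=
  inferInstanceAs (Ring (RingQuot (Rel R E V)))

/-- The quotient map from the free `R`-ring. -/
noncomputable def mk : WordRing R E₀ E₁ →+* RelLeavittPathRing R E V :=
  RingQuot.mkRingHom (Rel R E V)

/-- The structure map of `L^V_R(E)` as an `R`-ring, sending `c` to `c • 1`. -/
noncomputable def coeff : R →+* RelLeavittPathRing R E V :=
  (mk R E V).comp MonoidAlgebra.singleOneRingHom

/-- The vertex `a`, as an element of `L^V_R(E)`. -/
noncomputable def vertex (a : E₀) : RelLeavittPathRing R E V := mk R E V (WordRing.gen R (.vertex a))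

/-- The edge `e`, as an element of `L^V_R(E)`. -/
noncomputable def edge (e : E₁) : RelLeavittPathRing R E V := mk R E V (WordRing.gen R (.edge e))

/-- The ghost edge `e*`, as an element of `L^V_R(E)`. -/
noncomputable def ghost (e : E₁) : RelLeavittPathRing R E V := mk R E V (WordRing.gen R (.ghost e))

end RelLeavittPathRing

/-- The generating number of a ring `S`: the smallest positive integer `n` for which there is an
epimorphism of right `S`-modules `Sⁿ → Sⁿ⁺¹`, and `∞` if there is no such `n`, that is, if `S`
satisfies the rank condition. -/
noncomputable def gn (S : Type u) [Ring S] : ℕ∞ :=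
  sInf {k : ℕ∞ | ∃ n : ℕ, 0 < n ∧ k = (n : ℕ∞) ∧
    ∃ f : (Fin n → S) →ₗ[Sᵐᵒᵖ] (Fin (n + 1) → S), Function.Surjective f}

/-- Two rings are Morita equivalent if their categories of right modules (that is, of left modules
over the opposite rings) are equivalent as additive categories, and likewise their categories of
left modules. -/
def AreMoritaEquivalent (A : Type u) [Ring A] (B : Type v) [Ring B] : Prop :=
  IsMoritaEquivalent ℤ Aᵐᵒᵖ Bᵐᵒᵖ ∧ IsMoritaEquivalent ℤ A B

end LeavittPath

open LeavittPath

/-! Write `L` for the ring of `E`, `A` for the ring of `E_X`, and `ε` for the sum of the vertices in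
`X`. Since `X` is hereditary, every edge starting in `X` belongs to `E_X`, so the generators of `L`
named by `E_X` satisfy the relations of `A` inside `εLε`. This gives `cornerHom : A → εLε`, and
three facts are needed.

Injectivity (`cornerHom_injective`): without normal forms, one builds an `L`-action that detects
`A`. The model is `Lε`, whose elements are combinations of paths meeting `X` only in their last
vertex, with coefficients in `A`. Outside `X` edges prepend and ghost edges delete; inside `X` they
act on the coefficient. The operators act on all functions `E₀ → List E₁ → A`, with weights cutting
out the genuine paths (`extend`). Evaluation at the paths of length zero turns the action of the
image of `z ∈ A` into left multiplication by `z` (`eval_lift_extend`).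

Surjectivity (`cornerHom_surjective`): paths outside `X` followed by elements of the image of `A`
span a left ideal containing `ε` (`PathSpan.mul_left`). Multiplying by `ε` on the left kills every
term with a nontrivial path.

Fullness (`span_finsum_vertex_eq_top`): the vertices in `LεL` form a `V`-saturated set containing
`X`.

The rest is general theory of a full corner, with `1 = ∑ aᵢ ε bᵢ`. The functor `M ↦ εM` is an
equivalence, and surjections between free modules pass between `A` and `L` by explicit matrices:
upwards with the same rank, downwards with the rank multiplied by the number of summands. Hence the
inequality in general and equality only in the infinite case. -/

namespace LeavittPath

/-! ### Full corners and the functor `M ↦ εM`: full faithfulness -/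

section FullCorner

/-- A non-unital ring homomorphism `j : A → L` that identifies `A` with the corner `ε L ε` at the
full idempotent `ε = j 1`. -/
structure IsFullCorner {A : Type u} [Ring A] {L : Type v} [Ring L] (j : A →ₙ+* L) : Prop where
  injective : Function.Injective j
  exists_eq : ∀ z, ∃ a, j a = j 1 * z * j 1
  full : ∃ (n : ℕ) (a b : Fin n → L), ∑ i, a i * j 1 * b i = 1

variable {A : Type u} [Ring A] {L : Type v} [Ring L] {j : A →ₙ+* L}

theorem map_one_mul_map (j : A →ₙ+* L) (a : A) : j 1 * j a = j a := by
  rw [← map_mul, one_mul]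

theorem map_mul_map_one (j : A →ₙ+* L) (a : A) : j a * j 1 = j a := by
  rw [← map_mul, mul_one]

open MulOpposite in
theorem IsFullCorner.op (hj : IsFullCorner j) : IsFullCorner (NonUnitalRingHom.op j) where
  injective := by
    intro a b h
    exact unop_injective (hj.injective (op_injective h))
  exists_eq z := by
    obtain ⟨a, ha⟩ := hj.exists_eq z.unop
    refine ⟨MulOpposite.op a, unop_injective ?_⟩
    simpa [mul_assoc] using ha
  full := by
    obtain ⟨n, a, b, h⟩ := hj.full
    refine ⟨n, fun i => MulOpposite.op (b i), fun i => MulOpposite.op (a i), unop_injective ?_⟩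
    simpa [mul_assoc, Finset.unop_sum] using h

variable (j)

/-- The subgroup `ε M` of an `L`-module `M`, where `ε = j 1`. -/
def cornerSubgroup (M : Type*) [AddCommGroup M] [Module L M] : AddSubgroup M where
  carrier := {m | j 1 • m = m}
  add_mem' {a b} ha hb := by simp_all
  zero_mem' := by simp
  neg_mem' {a} ha := by simp_all

variable {j}
variable {M N : Type*} [AddCommGroup M] [Module L M] [AddCommGroup N] [Module L N]

theorem mem_cornerSubgroup {m : M} : m ∈ cornerSubgroup j M ↔ j 1 • m = m := Iff.rfl

theorem map_smul_mem_cornerSubgroup (a : A) (m : M) : j a • m ∈ cornerSubgroup j M := by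
  rw [mem_cornerSubgroup, smul_smul, map_one_mul_map]

theorem map_one_smul_coe (m : cornerSubgroup j M) : j 1 • (m : M) = m := m.2

instance : Module A (cornerSubgroup j M) where
  smul a m := ⟨j a • m.1, map_smul_mem_cornerSubgroup a m.1⟩
  one_smul m := Subtype.ext m.2
  mul_smul a b m := Subtype.ext (by
    change j (a * b) • m.1 = j a • j b • m.1
    rw [map_mul, mul_smul])
  smul_zero a := Subtype.ext (smul_zero (j a))
  smul_add a m n := Subtype.ext (smul_add (j a) m.1 n.1)
  add_smul a b m := Subtype.ext (by
    change j (a + b) • m.1 = j a • m.1 + j b • m.1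
    rw [map_add, add_smul])
  zero_smul m := Subtype.ext (by
    change j 0 • m.1 = 0
    rw [map_zero, zero_smul])

@[simp]
theorem coe_cornerSubgroup_smul (a : A) (m : cornerSubgroup j M) :
    ((a • m : cornerSubgroup j M) : M) = j a • (m : M) := rfl

variable (j) in
/-- The restriction of an `L`-linear map to the corners. -/
def cornerMap (f : M →ₗ[L] N) : cornerSubgroup j M →ₗ[A] cornerSubgroup j N where
  toFun m := ⟨f m.1, by rw [mem_cornerSubgroup, ← map_smul, map_one_smul_coe]⟩
  map_add' m n := Subtype.ext (map_add f m.1 n.1)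
  map_smul' a m := Subtype.ext (map_smul f (j a) m.1)

/-- Since `m = ∑ aᵢ (ε bᵢ m)`, an `L`-linear map is determined by its values on `εM`. -/
theorem IsFullCorner.cornerMap_injective (hj : IsFullCorner j) :
    Function.Injective (cornerMap j : (M →ₗ[L] N) → _) := by
  intro f g hfg
  obtain ⟨n, a, b, hab⟩ := hj.full
  ext m
  have key : ∀ z : L, f (j 1 • z • m) = g (j 1 • z • m) := fun z =>
    congrArg Subtype.val (DFunLike.congr_fun hfg
      (⟨_, map_smul_mem_cornerSubgroup 1 (z • m)⟩ : cornerSubgroup j M))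
  rw [← one_smul L m, ← hab, Finset.sum_smul, map_sum, map_sum]
  refine Finset.sum_congr rfl fun i _ => ?_
  rw [mul_assoc, mul_smul, mul_smul, map_smul, map_smul g, key]

/-- The same expansion forces the extension of `g` to be `m ↦ ∑ aᵢ g(ε bᵢ m)`; its `L`-linearity is
the point to check. -/
theorem IsFullCorner.cornerMap_surjective (hj : IsFullCorner j) :
    Function.Surjective (cornerMap j : (M →ₗ[L] N) → _) := by
  intro g
  obtain ⟨n, a, b, hab⟩ := hj.full
  -- Here `ε z m = ∑ (ε z aₖ ε)(ε bₖ m)`, and each `ε z aₖ ε` comes from `A`, so `g` can be moved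
  -- past it. With `z` replaced by `bᵢ z`, this gives linearity of `F`.
  have key (z : L) (m : M) :
      (g ⟨_, map_smul_mem_cornerSubgroup 1 (z • m)⟩ : N) =
        j 1 • ∑ k, (z * a k) •
          (g ⟨_, map_smul_mem_cornerSubgroup 1 (b k • m)⟩ : N) := by
    have h (k : Fin n) : ∃ c, j c = j 1 * (z * a k) * j 1 := hj.exists_eq _
    choose c hc using h
    have : (⟨_, map_smul_mem_cornerSubgroup 1 (z • m)⟩ : cornerSubgroup j M) =
        ∑ k, c k • ⟨_, map_smul_mem_cornerSubgroup 1 (b k • m)⟩ := by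
      apply Subtype.ext
      rw [AddSubgroup.val_finsetSum]
      simp only [coe_cornerSubgroup_smul, hc]
      conv_lhs => rw [← one_smul L m, ← hab, Finset.sum_smul, Finset.smul_sum, Finset.smul_sum]
      refine Finset.sum_congr rfl fun k _ => ?_
      simp only [smul_smul]
      congr 1
      simp only [mul_assoc]
      rw [← mul_assoc (j 1) (j 1), map_one_mul_map]
    rw [this, map_sum, AddSubgroup.val_finsetSum, Finset.smul_sum]
    refine Finset.sum_congr rfl fun k _ => ?_
    rw [map_smul, coe_cornerSubgroup_smul, hc, mul_smul, mul_smul, map_one_smul_coe]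
  let F : M →ₗ[L] N :=
    { toFun := fun m => ∑ i, a i • (g ⟨_, map_smul_mem_cornerSubgroup 1 (b i • m)⟩ : N)
      map_add' := by
        intro m m'
        rw [← Finset.sum_add_distrib]
        refine Finset.sum_congr rfl fun i _ => ?_
        rw [← smul_add, ← AddSubgroup.coe_add, ← map_add]
        congr 3
        apply Subtype.ext
        simp [smul_add]
      map_smul' := by
        intro z m
        simp only [RingHom.id_apply]
        have (i : Fin n) : (g ⟨_, map_smul_mem_cornerSubgroup 1 (b i • z • m)⟩ : N) =
            j 1 • b i • z • ∑ k, a k •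
              (g ⟨_, map_smul_mem_cornerSubgroup 1 (b k • m)⟩ : N) := by
          have h := key (b i * z) m
          simp only [mul_smul, ← Finset.smul_sum] at h
          exact h
        simp only [this]
        simp only [← mul_smul]
        rw [← Finset.sum_smul]
        simp only [← mul_assoc]
        rw [← Finset.sum_mul, hab, one_mul] }
  refine ⟨F, ?_⟩
  ext m
  change ∑ i, a i • (g ⟨_, map_smul_mem_cornerSubgroup 1 (b i • m.1)⟩ : N) = g m
  -- For `m` in `εM` one has `ε bᵢ m = (ε bᵢ ε) m`, again a scalar from `A`.
  have (i : Fin n) : (g ⟨_, map_smul_mem_cornerSubgroup 1 (b i • m.1)⟩ : N) =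
      j 1 • b i • g m := by
    have h2 : ∃ c, j c = j 1 * b i * j 1 := hj.exists_eq _
    obtain ⟨c, hc⟩ := h2
    have : (⟨_, map_smul_mem_cornerSubgroup 1 (b i • (m : M))⟩ : cornerSubgroup j M) = c • m := by
      apply Subtype.ext
      rw [coe_cornerSubgroup_smul, hc, mul_smul, mul_smul, map_one_smul_coe]
    rw [this, map_smul, coe_cornerSubgroup_smul, hc, mul_smul, mul_smul, map_one_smul_coe]
  simp only [this]
  simp only [← mul_smul]
  rw [← Finset.sum_smul]
  simp only [← mul_assoc]
  rw [hab, one_smul]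

end FullCorner

/-! ### Coinduced modules: essential surjectivity of `M ↦ εM` -/

section CoinducedModule

variable {A : Type u} [Ring A] {L : Type v} [Ring L] (j : A →ₙ+* L)
  (N : Type*) [AddCommGroup N] [Module A N]

/-- Right multiplication by an element of `L` on `ε L`. -/
def cornerMulRight (z : L) : cornerSubgroup j L →ₗ[A] cornerSubgroup j L where
  toFun y := ⟨y.1 * z, by
    rw [mem_cornerSubgroup, smul_eq_mul, ← mul_assoc, ← smul_eq_mul (j 1), map_one_smul_coe]⟩
  map_add' y y' := Subtype.ext (add_mul y.1 y'.1 z)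
  map_smul' a y := Subtype.ext (mul_assoc (j a) y.1 z)

/-- The `L`-module `Hom_A(ε L, N)` coinduced from an `A`-module `N`. -/
def Coinduced : Type _ := cornerSubgroup j L →ₗ[A] N

instance : AddCommGroup (Coinduced j N) :=
  inferInstanceAs (AddCommGroup (cornerSubgroup j L →ₗ[A] N))

variable {j N} in
/-- The underlying linear map of an element of the coinduced module. -/
def Coinduced.toLin (f : Coinduced j N) : cornerSubgroup j L →ₗ[A] N := f

instance : Module L (Coinduced j N) where
  smul z f := f.toLin.comp (cornerMulRight j z)
  one_smul f := LinearMap.ext fun y => congrArg f.toLin (Subtype.ext (mul_one y.1))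
  mul_smul z z' f := LinearMap.ext fun y =>
    congrArg f.toLin (Subtype.ext (mul_assoc y.1 z z').symm)
  smul_zero _ := LinearMap.ext fun _ => rfl
  smul_add _ _ _ := LinearMap.ext fun _ => rfl
  add_smul z z' f := LinearMap.ext fun y =>
    (congrArg f.toLin (Subtype.ext (mul_add y.1 z z'))).trans (map_add f.toLin _ _)
  zero_smul f := LinearMap.ext fun y =>
    (congrArg f.toLin (Subtype.ext (mul_zero y.1))).trans (map_zero f.toLin)

variable {j N} in
theorem Coinduced.toLin_smul (z : L) (f : Coinduced j N) (y : cornerSubgroup j L) :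
    (z • f).toLin y = f.toLin (cornerMulRight j z y) := rfl

/-- The idempotent `ε = j 1` as an element of `ε L`. -/
def cornerOne : cornerSubgroup j L := ⟨j 1, map_one_mul_map j 1⟩

theorem cornerMulRight_map_cornerOne (a : A) :
    cornerMulRight j (j a) (cornerOne j) = a • cornerOne j :=
  Subtype.ext ((map_one_mul_map j a).trans (map_mul_map_one j a).symm)

variable {j}

/-- The corner of the coinduced module `Hom_A(ε L, N)` is `N`. -/
noncomputable def cornerCoinducedEquiv (hj : IsFullCorner j) :
    cornerSubgroup j (Coinduced j N) ≃ₗ[A] N :=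
  LinearEquiv.ofBijective
    { toFun := fun f => f.1.toLin (cornerOne j)
      map_add' := fun f g => rfl
      map_smul' := fun a f => by
        change f.1.toLin (cornerMulRight j (j a) (cornerOne j)) = _
        rw [cornerMulRight_map_cornerOne, map_smul]
        rfl }
    (by
      -- For `y` in `εL`, the product `yε` lies in `εLε`, say `yε = j (c y)`. If `εf = f`, then
      -- `f(y) = f(yε) = c y • f(ε)`, so `f` is determined by `f(ε)`; conversely, `y ↦ c y • n`
      -- takes the value `n` at `ε`.
      have h (y : cornerSubgroup j L) : ∃ c, j c = y.1 * j 1 := by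
        obtain ⟨c, hc⟩ := hj.exists_eq y.1
        exact ⟨c, by rw [hc, ← smul_eq_mul (j 1), map_one_smul_coe]⟩
      choose c hc using h
      constructor
      · intro f g hfg
        apply Subtype.ext
        refine LinearMap.ext fun y => ?_
        have key (f : cornerSubgroup j (Coinduced j N)) :
            f.1.toLin y = c y • f.1.toLin (cornerOne j) := by
          conv_lhs => rw [← map_one_smul_coe f, Coinduced.toLin_smul]
          rw [← map_smul]
          congr 1
          apply Subtype.ext
          change y.1 * j 1 = j (c y) * j 1
          rw [map_mul_map_one, hc]
        exact (key f).trans ((congrArg (c y • ·) hfg).trans (key g).symm)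
      · intro n
        have hc1 : c (cornerOne j) = 1 := hj.injective (by
          rw [hc]; exact map_one_mul_map j 1)
        let f : Coinduced j N :=
          ({toFun := fun y => c y • n
            map_add' := fun y y' => by
              rw [← add_smul]
              congr 1
              apply hj.injective
              rw [map_add, hc, hc, hc, ← add_mul]
              rfl
            map_smul' := fun a y => by
              rw [RingHom.id_apply, smul_smul]
              congr 1
              apply hj.injective
              rw [map_mul, hc, hc, ← mul_assoc]
              rfl } : cornerSubgroup j L →ₗ[A] N)
        refine ⟨⟨f, LinearMap.ext fun y => ?_⟩, ?_⟩
        · change c (cornerMulRight j (j 1) y) • n = c y • n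
          congr 1
          apply hj.injective
          rw [hc, hc]
          change y.1 * j 1 * j 1 = _
          rw [mul_assoc, map_one_mul_map]
        · change c (cornerOne j) • n = n
          rw [hc1, one_smul])

end CoinducedModule

/-! ### Morita equivalence of a ring and its full corner -/

section Morita

open CategoryTheory

variable {A : Type u} [Ring A] {L : Type u} [Ring L]

/-- The functor `M ↦ ε M` from `L`-modules to `A`-modules. -/
def cornerFunctor (j : A →ₙ+* L) : ModuleCat.{u} L ⥤ ModuleCat.{u} A where
  obj M := ModuleCat.of A (cornerSubgroup j M)
  map f := ModuleCat.ofHom (cornerMap j f.hom)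
  map_id _ := rfl
  map_comp _ _ := rfl

variable {j : A →ₙ+* L}

theorem IsFullCorner.isEquivalence (hj : IsFullCorner j) : (cornerFunctor j).IsEquivalence where
  faithful := ⟨fun {_ _ f g} h =>
    ModuleCat.hom_ext (hj.cornerMap_injective (congrArg ModuleCat.Hom.hom h))⟩
  full := ⟨fun g => by
    obtain ⟨f, hf⟩ := hj.cornerMap_surjective g.hom
    exact ⟨ModuleCat.ofHom f, ModuleCat.hom_ext hf⟩⟩
  essSurj := ⟨fun N => ⟨ModuleCat.of L (Coinduced j N),
    ⟨(cornerCoinducedEquiv N hj).toModuleIso⟩⟩⟩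

theorem IsFullCorner.isMoritaEquivalent (hj : IsFullCorner j) : IsMoritaEquivalent ℤ A L :=
  have := hj.isEquivalence
  IsMoritaEquivalent.symm ℤ
    ⟨⟨{ eqv := (cornerFunctor j).asEquivalence
        linear := by
          refine @Functor.Linear.mk _ _ _ _ _ _ _ _ (_) (_) _ fun f r => ?_
          ext m
          apply Subtype.ext
          -- Although `j` is not unital, `j (r • 1) = r • ε` acts as `r` on `εM`.
          change (algebraMap ℤ L r) • f.hom m.1 = j (algebraMap ℤ A r) • f.hom m.1
          conv_lhs => rw [← map_one_smul_coe m, map_smul]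
          rw [smul_smul, Algebra.algebraMap_eq_smul_one (A := A), map_zsmul,
            Algebra.algebraMap_eq_smul_one (A := L), smul_mul_assoc, one_mul] }⟩⟩

theorem IsFullCorner.areMoritaEquivalent (hj : IsFullCorner j) : AreMoritaEquivalent A L :=
  ⟨hj.op.isMoritaEquivalent, hj.isMoritaEquivalent⟩

end Morita

/-! ### Generating numbers of full corners -/

section GeneratingNumber

/-- There is an epimorphism of free right `S`-modules `S^ι → S^κ`, expressed by matrices: a
`κ × ι` matrix over `S` has a right inverse. -/
def FreeSurjects (S : Type u) [Ring S] (ι κ : Type) [Fintype ι] [DecidableEq κ] : Prop :=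
  ∃ (P : Matrix κ ι S) (Q : Matrix ι κ S), P * Q = 1

variable {S : Type u} [Ring S] {ι κ τ : Type} [Fintype ι] [Fintype κ] [DecidableEq κ]
  [DecidableEq τ]

/-- Lifting the standard basis splits a surjection onto a free module. Matrices act on columns from
the left, hence linearly for right modules. -/
theorem exists_surjective_iff_freeSurjects (n m : ℕ) :
    (∃ f : (Fin n → S) →ₗ[Sᵐᵒᵖ] (Fin m → S), Function.Surjective f) ↔
      FreeSurjects S (Fin n) (Fin m) := by
  constructor
  · rintro ⟨f, hf⟩
    choose q hq using fun i : Fin m => hf (Pi.single i 1)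
    refine ⟨Matrix.of fun i k => f (Pi.single k 1) i, Matrix.of fun k i => q i k, ?_⟩
    ext i i'
    have h : q i' = ∑ k, MulOpposite.op (q i' k) • (Pi.single k (1 : S) : Fin n → S) := by
      ext k
      simp [Finset.sum_apply, Pi.single_apply]
    have h2 := congrFun (hq i') i
    rw [h, map_sum, Finset.sum_apply] at h2
    simp only [map_smul, Pi.smul_apply, MulOpposite.smul_eq_mul_unop, MulOpposite.unop_op] at h2
    rw [Matrix.mul_apply, Matrix.one_apply]
    simpa [Pi.single_apply] using h2
  · rintro ⟨P, Q, h⟩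
    refine ⟨{ toFun := fun v => P.mulVec v
              map_add' := fun v w => Matrix.mulVec_add P v w
              map_smul' := fun c v => Matrix.mulVec_smul P c v }, fun v => ⟨Q.mulVec v, ?_⟩⟩
    change P.mulVec (Q.mulVec v) = v
    rw [Matrix.mulVec_mulVec, h, Matrix.one_mulVec]

theorem FreeSurjects.trans (h : FreeSurjects S ι κ) (h' : FreeSurjects S κ τ) :
    FreeSurjects S ι τ := by
  obtain ⟨P, Q, h⟩ := h
  obtain ⟨P', Q', h'⟩ := h'
  exact ⟨P' * P, Q * Q', by
    rw [Matrix.mul_assoc, ← Matrix.mul_assoc P, h, Matrix.one_mul, h']⟩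

theorem FreeSurjects.succ {n m : ℕ} (h : FreeSurjects S (Fin n) (Fin m)) :
    FreeSurjects S (Fin (n + 1)) (Fin (m + 1)) := by
  obtain ⟨P, Q, h⟩ := h
  refine ⟨(Matrix.fromBlocks P 0 0 (1 : Matrix (Fin 1) (Fin 1) S)).submatrix
      finSumFinEquiv.symm finSumFinEquiv.symm,
    (Matrix.fromBlocks Q 0 0 (1 : Matrix (Fin 1) (Fin 1) S)).submatrix
      finSumFinEquiv.symm finSumFinEquiv.symm, ?_⟩
  rw [Matrix.submatrix_mul_equiv, Matrix.fromBlocks_multiply]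
  simp [h]

/-- Adding free summands lets the rank grow by one at every step from `n` on; composing the steps
reaches any larger rank. -/
theorem FreeSurjects.of_le {n : ℕ} (h : FreeSurjects S (Fin n) (Fin (n + 1))) {m k : ℕ}
    (hm : n ≤ m) (hk : m ≤ k) : FreeSurjects S (Fin m) (Fin k) := by
  induction k, hk using Nat.le_induction with
  | base => exact ⟨1, 1, Matrix.one_mul 1⟩
  | succ k hk ih =>
    refine ih.trans ?_
    have hn : n ≤ k := hm.trans hk
    clear ih hk
    induction k, hn using Nat.le_induction with
    | base => exact h
    | succ k _ ih => exact ih.succ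

theorem mem_surjective_sizes_iff (S : Type u) [Ring S] (k : ℕ∞) :
    k ∈ {k : ℕ∞ | ∃ n : ℕ, 0 < n ∧ k = (n : ℕ∞) ∧
      ∃ f : (Fin n → S) →ₗ[Sᵐᵒᵖ] (Fin (n + 1) → S), Function.Surjective f} ↔
    ∃ n : ℕ, 0 < n ∧ k = n ∧ FreeSurjects S (Fin n) (Fin (n + 1)) := by
  simp only [Set.mem_ofPred_eq, exists_surjective_iff_freeSurjects]

theorem gn_ne_top_iff (S : Type u) [Ring S] :
    gn S ≠ ⊤ ↔ ∃ n : ℕ, 0 < n ∧ FreeSurjects S (Fin n) (Fin (n + 1)) := by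
  rw [gn, Ne, sInf_eq_top]
  simp only [mem_surjective_sizes_iff]
  constructor
  · intro h
    push Not at h
    obtain ⟨k, ⟨n, hn, rfl, h⟩, _⟩ := h
    exact ⟨n, hn, h⟩
  · rintro ⟨n, hn, h⟩ h'
    exact ENat.natCast_ne_top n (h' n ⟨n, hn, rfl, h⟩)

variable {A : Type u} [Ring A] {L : Type v} [Ring L] {j : A →ₙ+* L}

/-- With `k` summands in `1 = ∑ aₜ ε bₜ`, the module `L^(n+1)` is a quotient of `(εL)^((n+1)k)`.
Enlarging the target over `A` to rank `(n+1)k` therefore keeps the source rank `n`. -/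
theorem IsFullCorner.freeSurjects_of_corner (hj : IsFullCorner j) {n : ℕ}
    (h : FreeSurjects A (Fin n) (Fin (n + 1))) : FreeSurjects L (Fin n) (Fin (n + 1)) := by
  obtain ⟨k, a, b, hab⟩ := hj.full
  have hk : n ≤ (n + 1) * k ∨ k = 0 := by
    rcases Nat.eq_zero_or_pos k with hk | hk
    · exact .inr hk
    · exact .inl (by nlinarith)
  rcases hk with hk | rfl
  · obtain ⟨P, Q, hPQ⟩ := h.of_le le_rfl hk
    refine ⟨Matrix.of fun i c => ∑ t, a t * j (P (finProdFinEquiv (i, t)) c),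
      Matrix.of fun c i => ∑ t, j (Q c (finProdFinEquiv (i, t))) * b t, ?_⟩
    have key (x y) : ∑ c, j (P x c) * j (Q c y) = if x = y then j 1 else 0 := by
      have := congrArg j (congrFun (congrFun hPQ x) y)
      rw [Matrix.mul_apply, map_sum] at this
      simp only [map_mul] at this
      rw [this, Matrix.one_apply]
      split_ifs <;> simp
    ext i i'
    rw [Matrix.mul_apply]
    simp only [Matrix.of_apply, Finset.sum_mul_sum]
    calc _ = ∑ t, ∑ t', a t * (∑ c, j (P (finProdFinEquiv (i, t)) c) *
              j (Q c (finProdFinEquiv (i', t')))) * b t' := by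
          rw [Finset.sum_comm]
          refine Finset.sum_congr rfl fun t _ => ?_
          rw [Finset.sum_comm]
          refine Finset.sum_congr rfl fun t' _ => ?_
          rw [Finset.mul_sum, Finset.sum_mul]
          exact Finset.sum_congr rfl fun c _ => by simp only [mul_assoc]
      _ = _ := by
          simp only [key, EmbeddingLike.apply_eq_iff_eq, Prod.mk.injEq, Matrix.one_apply]
          by_cases hi : i = i'
          · simpa [hi] using hab
          · simp [hi]
  -- An empty decomposition of `1` forces `L = 0`.
  · have : Subsingleton L := subsingleton_of_zero_eq_one (by simpa using hab)
    exact ⟨0, 0, Subsingleton.elim _ _⟩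

/-- The right `A`-module `Lε` is generated by the `k` elements `aₜ ε`, so `(Lε)^n` needs up to `nk`
generators. Only finiteness of the generating number descends this way, not its value. -/
theorem IsFullCorner.exists_freeSurjects (hj : IsFullCorner j) {n : ℕ} (hn : 0 < n)
    (h : FreeSurjects L (Fin n) (Fin (n + 1))) :
    ∃ m : ℕ, 0 < m ∧ FreeSurjects A (Fin m) (Fin (m + 1)) := by
  obtain ⟨k, a, b, hab⟩ := hj.full
  rcases Nat.eq_zero_or_pos k with rfl | hk
  · have h1 : (1 : L) = 0 := by rw [← hab]; simp
    have : Subsingleton A := subsingleton_of_zero_eq_one (hj.injective (by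
      rw [← one_mul (j 0), ← one_mul (j 1), h1, zero_mul, zero_mul]))
    exact ⟨1, one_pos, 0, 0, Subsingleton.elim _ _⟩
  · refine ⟨n * k, Nat.mul_pos hn hk, ?_⟩
    obtain ⟨P, Q, hPQ⟩ := h.of_le le_rfl (k := n * k + 1) (by nlinarith)
    choose c hc using hj.exists_eq
    refine ⟨Matrix.of fun i y => c (P i (finProdFinEquiv.symm y).1 * a (finProdFinEquiv.symm y).2),
      Matrix.of fun y i => c (b (finProdFinEquiv.symm y).2 * Q (finProdFinEquiv.symm y).1 i), ?_⟩
    ext i i'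
    apply hj.injective
    have hε : j 1 * j 1 = j 1 := map_one_mul_map j 1
    rw [Matrix.mul_apply, map_sum, ← Equiv.sum_comp finProdFinEquiv, Fintype.sum_prod_type]
    simp only [Matrix.of_apply, Equiv.symm_apply_apply, map_mul, hc]
    calc _ = ∑ x, j 1 * P i x * (∑ t, a t * j 1 * b t) * Q x i' * j 1 := by
          refine Finset.sum_congr rfl fun x _ => ?_
          simp only [Finset.mul_sum, Finset.sum_mul]
          refine Finset.sum_congr rfl fun t _ => ?_
          simp only [mul_assoc]
          rw [← mul_assoc (j 1) (j 1), hε]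
      _ = j 1 * (∑ x, P i x * Q x i') * j 1 := by
          rw [hab]
          simp only [mul_one, Finset.mul_sum, Finset.sum_mul, mul_assoc]
      _ = _ := by
          rw [← Matrix.mul_apply, hPQ, Matrix.one_apply, Matrix.one_apply]
          split_ifs <;> simp [hε]

theorem IsFullCorner.gn_le (hj : IsFullCorner j) : gn L ≤ gn A := by
  refine le_sInf fun k hk => sInf_le ?_
  rw [mem_surjective_sizes_iff] at hk ⊢
  obtain ⟨n, hn, rfl, h⟩ := hk
  exact ⟨n, hn, rfl, hj.freeSurjects_of_corner h⟩

theorem IsFullCorner.gn_eq (hj : IsFullCorner j) (h : gn L = ⊤ ∨ gn A = ⊤) : gn L = gn A := by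
  have hA : gn A = ⊤ := by
    rcases h with h | h
    · exact top_le_iff.1 (h ▸ hj.gn_le)
    · exact h
  rw [hA]
  by_contra hL
  obtain ⟨n, hn, h⟩ := (gn_ne_top_iff L).1 hL
  exact (gn_ne_top_iff A).2 (hj.exists_freeSurjects hn h) hA

end GeneratingNumber

/-! ### Corners at an idempotent of a ring -/

section Corner

variable {S : Type*} [Ring S] {ε : S}

/-- The inclusion of a corner, as a non-unital ring homomorphism. -/
def cornerVal (hε : IsIdempotentElem ε) : hε.Corner →ₙ+* S where
  toFun z := z.1
  map_mul' _ _ := rfl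
  map_zero' := rfl
  map_add' _ _ := rfl

theorem cornerVal_apply (hε : IsIdempotentElem ε) (z : hε.Corner) : cornerVal hε z = z.1 := rfl

theorem cornerVal_injective (hε : IsIdempotentElem ε) : Function.Injective (cornerVal hε) :=
  Subtype.val_injective

theorem cornerVal_one (hε : IsIdempotentElem ε) : cornerVal hε 1 = ε := rfl

theorem exists_sum_of_mem_span {z : S} (hz : z ∈ TwoSidedIdeal.span {ε}) :
    ∃ (n : ℕ) (a b : Fin n → S), ∑ i, a i * ε * b i = z := by
  rw [TwoSidedIdeal.mem_span_iff_mem_addSubgroup_closure] at hz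
  induction hz using AddSubgroup.closure_induction with
  | mem x hx =>
    obtain ⟨-, ⟨a, -, -, rfl, rfl⟩, b, -, rfl⟩ := hx
    exact ⟨1, fun _ => a, fun _ => b, by simp⟩
  | zero => exact ⟨0, 0, 0, by simp⟩
  | add x y _ _ hx hy =>
    obtain ⟨n, a, b, rfl⟩ := hx
    obtain ⟨m, c, d, rfl⟩ := hy
    exact ⟨n + m, Fin.append a c, Fin.append b d, by simp [Fin.sum_univ_add]⟩
  | neg x _ hx =>
    obtain ⟨n, a, b, rfl⟩ := hx
    exact ⟨n, fun i => -a i, b, by simp⟩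

end Corner

variable {R : Type u} [Ring R] {E₀ : Type v} {E₁ : Type w} {E : DirectedGraph E₀ E₁} {V : Set E₀}

theorem DirectedGraph.IsHereditary.rng_mem {X : Set E₀} (hX : E.IsHereditary X) {e : E₁}
    (h : E.src e ∈ X) : E.rng e ∈ X :=
  hX _ h _ ⟨[e], rfl, rfl⟩

/-! ### Generators of the relative Leavitt path ring -/

namespace RelLeavittPathRing

theorem induction {p : RelLeavittPathRing R E V → Prop}
    (coeff : ∀ c, p (coeff R E V c)) (vertex : ∀ a, p (vertex R E V a))
    (edge : ∀ e, p (edge R E V e)) (ghost : ∀ e, p (ghost R E V e))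
    (add : ∀ y z, p y → p z → p (y + z)) (mul : ∀ y z, p y → p z → p (y * z))
    (z : RelLeavittPathRing R E V) : p z := by
  obtain ⟨z, rfl⟩ : ∃ y, mk R E V y = z := RingQuot.mkRingHom_surjective (Rel R E V) z
  induction z using MonoidAlgebra.induction_linear with
  | zero => simpa using coeff 0
  | add y z hy hz => rw [map_add]; exact add _ _ hy hz
  | single m r =>
    have : (MonoidAlgebra.single m r : WordRing R E₀ E₁) =
        MonoidAlgebra.single 1 r * MonoidAlgebra.single m 1 := by
      rw [MonoidAlgebra.single_mul_single, one_mul, mul_one]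
    rw [this, map_mul]
    refine mul _ _ (coeff r) ?_
    induction m using FreeMonoid.inductionOn' with
    | one => exact coeff 1
    | of_mul g m hm =>
      have : (MonoidAlgebra.single (FreeMonoid.of g * m) 1 : WordRing R E₀ E₁) =
          WordRing.gen R g * MonoidAlgebra.single m 1 := by
        rw [WordRing.gen, MonoidAlgebra.single_mul_single, one_mul]
      rw [this, map_mul]
      refine mul _ _ ?_ (hm ?_)
      · cases g with
        | vertex a => exact vertex a
        | edge e => exact edge e
        | ghost e => exact ghost e
      · rw [MonoidAlgebra.single_mul_single, one_mul, mul_one]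

variable (R E V)

theorem mk_eq_of_rel {y z : WordRing R E₀ E₁} (h : Rel R E V y z) : mk R E V y = mk R E V z :=
  RingQuot.mkRingHom_rel h

theorem finsum_vertex [Finite E₀] : ∑ᶠ a, vertex R E V a = 1 := by
  have := mk_eq_of_rel R E V .sum_vertex
  rwa [map_finsum _ (Set.toFinite _), map_one] at this

theorem commute_coeff_gen (c : R) (g : Gen E₀ E₁) :
    Commute (coeff R E V c) (mk R E V (WordRing.gen R g)) := by
  change mk R E V _ * mk R E V _ = mk R E V _ * mk R E V _
  rw [← map_mul, ← map_mul]
  congr 1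
  change MonoidAlgebra.single 1 c * MonoidAlgebra.single _ 1 =
    MonoidAlgebra.single _ 1 * MonoidAlgebra.single 1 c
  simp [MonoidAlgebra.single_mul_single]

end RelLeavittPathRing

/-! ### Families satisfying the relations, and the universal property -/

/-- Elements of a ring `S` that satisfy the relations of `L^V_R(E)`, except that the sum of the
vertices need not be `1`. -/
structure LeavittFamily (R : Type u) [Ring R] {E₀ : Type v} {E₁ : Type w} (E : DirectedGraph E₀ E₁)
    (V : Set E₀) (S : Type*) [Ring S] where
  coeff : R →+* S
  vertex : E₀ → S
  edge : E₁ → S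
  ghost : E₁ → S
  commute_vertex (c : R) (a : E₀) : Commute (coeff c) (vertex a)
  commute_edge (c : R) (e : E₁) : Commute (coeff c) (edge e)
  commute_ghost (c : R) (e : E₁) : Commute (coeff c) (ghost e)
  vertex_mul_self (a : E₀) : vertex a * vertex a = vertex a
  vertex_mul_of_ne (a b : E₀) (h : a ≠ b) : vertex a * vertex b = 0
  src_mul_edge (e : E₁) : vertex (E.src e) * edge e = edge e
  edge_mul_rng (e : E₁) : edge e * vertex (E.rng e) = edge e
  rng_mul_ghost (e : E₁) : vertex (E.rng e) * ghost e = ghost e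
  ghost_mul_src (e : E₁) : ghost e * vertex (E.src e) = ghost e
  ghost_mul_edge (e : E₁) : ghost e * edge e = vertex (E.rng e)
  ghost_mul_edge_of_ne (e f : E₁) (h : e ≠ f) : ghost e * edge f = 0
  sum_edge_mul_ghost (a : E₀) (ha : a ∈ V) (hfin : (E.out a).Finite) :
    ∑ e ∈ hfin.toFinset, edge e * ghost e = vertex a

namespace LeavittFamily

variable {S : Type*} [Ring S] (F : LeavittFamily R E V S)

section

variable [Finite E₀]

theorem finsum_mul_vertex (a : E₀) : (∑ᶠ b, F.vertex b) * F.vertex a = F.vertex a := by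
  rw [finsum_mul' _ _ (Set.toFinite _), finsum_eq_single _ a fun b hb => F.vertex_mul_of_ne b a hb,
    F.vertex_mul_self]

theorem vertex_mul_finsum (a : E₀) : F.vertex a * (∑ᶠ b, F.vertex b) = F.vertex a := by
  rw [mul_finsum' _ _ (Set.toFinite _),
    finsum_eq_single _ a fun b hb => F.vertex_mul_of_ne a b hb.symm, F.vertex_mul_self]

theorem isIdempotentElem_finsum : IsIdempotentElem (∑ᶠ a, F.vertex a) := by
  rw [IsIdempotentElem]
  conv_lhs => rw [finsum_mul' _ _ (Set.toFinite _)]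
  exact finsum_congr F.vertex_mul_finsum

theorem mem_corner_of_mul {z : S} {a b : E₀} (ha : F.vertex a * z = z) (hb : z * F.vertex b = z) :
    z ∈ NonUnitalRing.corner (∑ᶠ a, F.vertex a) :=
  (Subsemigroup.mem_corner_iff F.isIdempotentElem_finsum).2
    ⟨by rw [← ha, ← mul_assoc, F.finsum_mul_vertex], by rw [← hb, mul_assoc, F.vertex_mul_finsum]⟩

theorem commute_finsum (c : R) : Commute (F.coeff c) (∑ᶠ a, F.vertex a) := by
  rw [finsum_eq_sum_of_support_subset _ (s := (Set.toFinite Set.univ).toFinset) (by simp)]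
  exact Commute.sum_right _ _ _ fun a _ => F.commute_vertex c a

/-- The generators, as elements of the corner at the sum of the vertices. -/
noncomputable def cornerGen : Gen E₀ E₁ → F.isIdempotentElem_finsum.Corner
  | .vertex a => ⟨F.vertex a, F.mem_corner_of_mul (F.vertex_mul_self a) (F.vertex_mul_self a)⟩
  | .edge e => ⟨F.edge e, F.mem_corner_of_mul (F.src_mul_edge e) (F.edge_mul_rng e)⟩
  | .ghost e => ⟨F.ghost e, F.mem_corner_of_mul (F.rng_mul_ghost e) (F.ghost_mul_src e)⟩

/-- The coefficients, as elements of the corner at the sum of the vertices. -/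
noncomputable def cornerCoeff : R →+* F.isIdempotentElem_finsum.Corner where
  toFun c := ⟨F.coeff c * ∑ᶠ a, F.vertex a, (Subsemigroup.mem_corner_iff
    F.isIdempotentElem_finsum).2 ⟨by
      rw [(F.commute_finsum c).eq, ← mul_assoc, F.isIdempotentElem_finsum.eq], by
      rw [mul_assoc, F.isIdempotentElem_finsum.eq]⟩⟩
  map_one' := Subtype.ext (by
    change F.coeff 1 * _ = _
    rw [map_one, one_mul]
    rfl)
  map_mul' c d := Subtype.ext (by
    change F.coeff (c * d) * _ = (F.coeff c * _) * (F.coeff d * _)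
    rw [map_mul, mul_assoc, mul_assoc, ← mul_assoc (∑ᶠ a, F.vertex a) (F.coeff d),
      ← (F.commute_finsum d).eq, mul_assoc, F.isIdempotentElem_finsum.eq])
  map_zero' := Subtype.ext (by
    change F.coeff 0 * _ = 0
    rw [map_zero, zero_mul])
  map_add' c d := Subtype.ext (by
    change F.coeff (c + d) * _ = F.coeff c * _ + F.coeff d * _
    rw [map_add, add_mul])

theorem commute_coeff_gen (c : R) (g : Gen E₀ E₁) : Commute (F.cornerCoeff c) (F.cornerGen g) := by
  have key {z : S} (hz : z ∈ NonUnitalRing.corner (∑ᶠ a, F.vertex a)) (hc : Commute (F.coeff c) z) :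
      (F.coeff c * ∑ᶠ a, F.vertex a) * z = z * (F.coeff c * ∑ᶠ a, F.vertex a) := by
    have hz := (Subsemigroup.mem_corner_iff F.isIdempotentElem_finsum).1 hz
    rw [mul_assoc, hz.1, ← mul_assoc, ← hc.eq, mul_assoc, hz.2]
  refine Subtype.ext (key (F.cornerGen g).2 ?_)
  cases g with
  | vertex a => exact F.commute_vertex c a
  | edge e => exact F.commute_edge c e
  | ghost e => exact F.commute_ghost c e

/-- The ring homomorphism from the free `R`-ring to the corner at the sum of the vertices. -/
noncomputable def wordLift : WordRing R E₀ E₁ →+* F.isIdempotentElem_finsum.Corner :=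
  MonoidAlgebra.liftNCRingHom F.cornerCoeff (FreeMonoid.lift F.cornerGen) fun c m => by
    induction m using FreeMonoid.inductionOn' with
    | one => exact Commute.one_right _
    | of_mul g m hm =>
      rw [map_mul, FreeMonoid.lift_eval_of]
      exact (F.commute_coeff_gen c g).mul_right hm

theorem wordLift_gen (g : Gen E₀ E₁) : F.wordLift (WordRing.gen R g) = F.cornerGen g := by
  rw [wordLift, WordRing.gen, MonoidAlgebra.liftNCRingHom_single, map_one, one_mul,
    FreeMonoid.lift_eval_of]

theorem wordLift_rel {y z : WordRing R E₀ E₁} (h : Rel R E V y z) :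
    F.wordLift y = F.wordLift z := by
  apply cornerVal_injective
  cases h with
  | vertex_mul_self a => simpa [wordLift_gen] using! F.vertex_mul_self a
  | vertex_mul_of_ne a b h => simpa [wordLift_gen] using! F.vertex_mul_of_ne a b h
  | src_mul_edge e => simpa [wordLift_gen] using! F.src_mul_edge e
  | edge_mul_rng e => simpa [wordLift_gen] using! F.edge_mul_rng e
  | sum_vertex =>
    -- The sum of the vertices is the identity of the corner; this is why the target is the corner
    -- and not `S`.
    rw [map_finsum _ (Set.toFinite _), map_one, cornerVal_one,
      ← NonUnitalRingHom.coe_toAddMonoidHom, map_finsum _ (Set.toFinite _)]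
    exact finsum_congr fun a => by rw [wordLift_gen]; rfl
  | rng_mul_ghost e => simpa [wordLift_gen] using! F.rng_mul_ghost e
  | ghost_mul_src e => simpa [wordLift_gen] using! F.ghost_mul_src e
  | ghost_mul_edge e => simpa [wordLift_gen] using! F.ghost_mul_edge e
  | ghost_mul_edge_of_ne e f h => simpa [wordLift_gen] using! F.ghost_mul_edge_of_ne e f h
  | sum_edge_mul_ghost a ha hfin =>
    rw [wordLift_gen, map_sum, map_sum]
    refine Eq.trans (Finset.sum_congr rfl fun e _ => ?_) (F.sum_edge_mul_ghost a ha hfin)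
    rw [map_mul, wordLift_gen, wordLift_gen]
    rfl

/-- The universal property of `L^V_R(E)`: a family of elements of `S` that satisfies the relations
yields a ring homomorphism to the corner at the sum of the vertices. -/
noncomputable def lift : RelLeavittPathRing R E V →+* F.isIdempotentElem_finsum.Corner :=
  RingQuot.lift ⟨F.wordLift, fun _ _ h => F.wordLift_rel h⟩

theorem lift_mk (z : WordRing R E₀ E₁) : F.lift (RelLeavittPathRing.mk R E V z) = F.wordLift z :=
  RingQuot.lift_mkRingHom_apply _ _ _

@[simp]
theorem lift_vertex (a : E₀) : (F.lift (RelLeavittPathRing.vertex R E V a)).1 = F.vertex a := by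
  rw [RelLeavittPathRing.vertex, lift_mk, wordLift_gen]; rfl

@[simp]
theorem lift_edge (e : E₁) : (F.lift (RelLeavittPathRing.edge R E V e)).1 = F.edge e := by
  rw [RelLeavittPathRing.edge, lift_mk, wordLift_gen]; rfl

@[simp]
theorem lift_ghost (e : E₁) : (F.lift (RelLeavittPathRing.ghost R E V e)).1 = F.ghost e := by
  rw [RelLeavittPathRing.ghost, lift_mk, wordLift_gen]; rfl

@[simp]
theorem lift_coeff (c : R) : (F.lift (RelLeavittPathRing.coeff R E V c)).1 =
    F.coeff c * ∑ᶠ a, F.vertex a := by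
  have : F.wordLift (MonoidAlgebra.singleOneRingHom c) = F.cornerCoeff c :=
    (MonoidAlgebra.liftNCRingHom_single _ _ _ _ _).trans (by rw [map_one, mul_one])
  rw [RelLeavittPathRing.coeff, RingHom.comp_apply, lift_mk, this]
  rfl

end

variable (R E V) in
open RelLeavittPathRing in
/-- The generators of `L^V_R(E)` satisfy the relations. -/
noncomputable def universal : LeavittFamily R E V (RelLeavittPathRing R E V) where
  coeff := RelLeavittPathRing.coeff R E V
  vertex := RelLeavittPathRing.vertex R E V
  edge := RelLeavittPathRing.edge R E V
  ghost := RelLeavittPathRing.ghost R E V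
  commute_vertex c _ := RelLeavittPathRing.commute_coeff_gen R E V c _
  commute_edge c _ := RelLeavittPathRing.commute_coeff_gen R E V c _
  commute_ghost c _ := RelLeavittPathRing.commute_coeff_gen R E V c _
  vertex_mul_self a := (map_mul _ _ _).symm.trans (mk_eq_of_rel R E V (.vertex_mul_self a))
  vertex_mul_of_ne a b h := (map_mul _ _ _).symm.trans
    ((mk_eq_of_rel R E V (.vertex_mul_of_ne a b h)).trans (map_zero _))
  src_mul_edge e := (map_mul _ _ _).symm.trans (mk_eq_of_rel R E V (.src_mul_edge e))
  edge_mul_rng e := (map_mul _ _ _).symm.trans (mk_eq_of_rel R E V (.edge_mul_rng e))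
  rng_mul_ghost e := (map_mul _ _ _).symm.trans (mk_eq_of_rel R E V (.rng_mul_ghost e))
  ghost_mul_src e := (map_mul _ _ _).symm.trans (mk_eq_of_rel R E V (.ghost_mul_src e))
  ghost_mul_edge e := (map_mul _ _ _).symm.trans (mk_eq_of_rel R E V (.ghost_mul_edge e))
  ghost_mul_edge_of_ne e f h := (map_mul _ _ _).symm.trans
    ((mk_eq_of_rel R E V (.ghost_mul_edge_of_ne e f h)).trans (map_zero _))
  sum_edge_mul_ghost a ha hfin := by
    refine Eq.trans ?_ (mk_eq_of_rel R E V (.sum_edge_mul_ghost a ha hfin))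
    rw [map_sum]
    exact Finset.sum_congr rfl fun e _ => (map_mul _ _ _).symm

variable {X : Set E₀}

/-- The restriction of a family to a hereditary set of vertices. -/
def restrict (hX : E.IsHereditary X) :
    LeavittFamily R (E.restrict X) (Subtype.val ⁻¹' V) S where
  coeff := F.coeff
  vertex x := F.vertex x.1
  edge e := F.edge e.1
  ghost e := F.ghost e.1
  commute_vertex c _ := F.commute_vertex c _
  commute_edge c _ := F.commute_edge c _
  commute_ghost c _ := F.commute_ghost c _
  vertex_mul_self _ := F.vertex_mul_self _
  vertex_mul_of_ne _ _ h := F.vertex_mul_of_ne _ _ fun h' => h (Subtype.ext h')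
  src_mul_edge _ := F.src_mul_edge _
  edge_mul_rng _ := F.edge_mul_rng _
  rng_mul_ghost _ := F.rng_mul_ghost _
  ghost_mul_src _ := F.ghost_mul_src _
  ghost_mul_edge _ := F.ghost_mul_edge _
  ghost_mul_edge_of_ne _ _ h := F.ghost_mul_edge_of_ne _ _ fun h' => h (Subtype.ext h')
  sum_edge_mul_ghost a ha hfin := by
    -- By heredity a vertex in `X` emits the same edges in `E_X` as in `E`, so its summation
    -- relation is unchanged.
    have hout : E.out a.1 = Subtype.val '' (E.restrict X).out a := by
      ext e
      constructor
      · intro he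
        have hs : E.src e ∈ X := by rw [show E.src e = a.1 from he]; exact a.2
        exact ⟨⟨e, hs, hX.rng_mem hs⟩, Subtype.ext he, rfl⟩
      · rintro ⟨e, he, rfl⟩
        exact congrArg Subtype.val he
    have hfin' : (E.out a.1).Finite := hout ▸ hfin.image _
    rw [← F.sum_edge_mul_ghost a.1 ha hfin']
    refine Finset.sum_bij (fun e _ => e.1) ?_ (fun _ _ _ _ h => Subtype.ext h) ?_ fun _ _ => rfl
    · intro e he
      rw [Set.Finite.mem_toFinset] at he ⊢
      exact hout ▸ ⟨e, he, rfl⟩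
    · intro e he
      rw [Set.Finite.mem_toFinset, hout] at he
      obtain ⟨e, he, rfl⟩ := he
      exact ⟨e, hfin.mem_toFinset.2 he, rfl⟩

end LeavittFamily

namespace LeavittFamily

/-! ### Extending a family from `E_X` to `E` by operators on functions of paths -/

section Extension

variable {X : Set E₀} {A : Type*} [Ring A]
  (F : LeavittFamily R (E.restrict X) (Subtype.val ⁻¹' V) A)

open Classical in
/-- The vertices of a family for `E_X`, extended by zero to the vertices of `E`. -/
noncomputable def vertexExt (a : E₀) : A := if h : a ∈ X then F.vertex ⟨a, h⟩ else 0

open Classical in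
/-- The edges of a family for `E_X`, extended by zero to the edges of `E`. -/
noncomputable def edgeExt (e : E₁) : A :=
  if h : E.src e ∈ X ∧ E.rng e ∈ X then F.edge ⟨e, h⟩ else 0

open Classical in
/-- The ghost edges of a family for `E_X`, extended by zero to the ghost edges of `E`. -/
noncomputable def ghostExt (e : E₁) : A :=
  if h : E.src e ∈ X ∧ E.rng e ∈ X then F.ghost ⟨e, h⟩ else 0

theorem vertexExt_of_mem {a : E₀} (h : a ∈ X) : F.vertexExt a = F.vertex ⟨a, h⟩ := dif_pos h

theorem vertexExt_of_notMem {a : E₀} (h : a ∉ X) : F.vertexExt a = 0 := dif_neg h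

theorem edgeExt_of_mem {e : E₁} (h : E.src e ∈ X ∧ E.rng e ∈ X) :
    F.edgeExt e = F.edge ⟨e, h⟩ := dif_pos h

theorem edgeExt_of_notMem {e : E₁} (h : E.src e ∉ X) : F.edgeExt e = 0 := dif_neg fun h' => h h'.1

theorem ghostExt_of_mem {e : E₁} (h : E.src e ∈ X ∧ E.rng e ∈ X) :
    F.ghostExt e = F.ghost ⟨e, h⟩ := dif_pos h

theorem ghostExt_of_notMem {e : E₁} (h : E.src e ∉ X) : F.ghostExt e = 0 :=
  dif_neg fun h' => h h'.1

theorem commute_vertexExt (c : R) (a : E₀) : Commute (F.coeff c) (F.vertexExt a) := by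
  unfold vertexExt
  split_ifs
  · exact F.commute_vertex _ _
  · exact Commute.zero_right _

theorem commute_edgeExt (c : R) (e : E₁) : Commute (F.coeff c) (F.edgeExt e) := by
  unfold edgeExt
  split_ifs
  · exact F.commute_edge _ _
  · exact Commute.zero_right _

theorem commute_ghostExt (c : R) (e : E₁) : Commute (F.coeff c) (F.ghostExt e) := by
  unfold ghostExt
  split_ifs
  · exact F.commute_ghost _ _
  · exact Commute.zero_right _

theorem vertexExt_mul_self (a : E₀) : F.vertexExt a * F.vertexExt a = F.vertexExt a := by
  unfold vertexExt
  split_ifs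
  · exact F.vertex_mul_self _
  · exact mul_zero _

theorem vertexExt_mul_of_ne {a b : E₀} (h : a ≠ b) : F.vertexExt a * F.vertexExt b = 0 := by
  unfold vertexExt
  split_ifs
  · exact F.vertex_mul_of_ne _ _ fun h' => h (congrArg Subtype.val h')
  all_goals simp

theorem src_mul_edgeExt (e : E₁) : F.vertexExt (E.src e) * F.edgeExt e = F.edgeExt e := by
  by_cases h : E.src e ∈ X ∧ E.rng e ∈ X
  · rw [F.vertexExt_of_mem h.1, F.edgeExt_of_mem h]
    exact F.src_mul_edge ⟨e, h⟩
  · rw [edgeExt, dif_neg h, mul_zero]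

theorem edgeExt_mul_rng (e : E₁) : F.edgeExt e * F.vertexExt (E.rng e) = F.edgeExt e := by
  by_cases h : E.src e ∈ X ∧ E.rng e ∈ X
  · rw [F.vertexExt_of_mem h.2, F.edgeExt_of_mem h]
    exact F.edge_mul_rng ⟨e, h⟩
  · rw [edgeExt, dif_neg h, zero_mul]

theorem rng_mul_ghostExt (e : E₁) : F.vertexExt (E.rng e) * F.ghostExt e = F.ghostExt e := by
  by_cases h : E.src e ∈ X ∧ E.rng e ∈ X
  · rw [F.vertexExt_of_mem h.2, F.ghostExt_of_mem h]
    exact F.rng_mul_ghost ⟨e, h⟩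
  · rw [ghostExt, dif_neg h, mul_zero]

theorem ghostExt_mul_src (e : E₁) : F.ghostExt e * F.vertexExt (E.src e) = F.ghostExt e := by
  by_cases h : E.src e ∈ X ∧ E.rng e ∈ X
  · rw [F.vertexExt_of_mem h.1, F.ghostExt_of_mem h]
    exact F.ghost_mul_src ⟨e, h⟩
  · rw [ghostExt, dif_neg h, zero_mul]

/-- The condition on the source matters: for an edge entering `X` from outside, the left side is `0`
while the right side need not be. Extension by zero alone is thus not a family for `E`, and paths
are needed to repair it. -/
theorem ghostExt_mul_edgeExt (hX : E.IsHereditary X) {e : E₁} (h : E.src e ∈ X) :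
    F.ghostExt e * F.edgeExt e = F.vertexExt (E.rng e) := by
  have h' := hX.rng_mem h
  rw [F.edgeExt_of_mem ⟨h, h'⟩, F.ghostExt_of_mem ⟨h, h'⟩, F.vertexExt_of_mem h']
  exact F.ghost_mul_edge ⟨e, h, h'⟩

theorem ghostExt_mul_edgeExt_of_ne {e f : E₁} (h : e ≠ f) : F.ghostExt e * F.edgeExt f = 0 := by
  unfold ghostExt edgeExt
  split_ifs
  · exact F.ghost_mul_edge_of_ne _ _ fun h' => h (congrArg Subtype.val h')
  all_goals simp

theorem sum_edgeExt_mul_ghostExt (hX : E.IsHereditary X) {a : E₀} (ha : a ∈ V) (h : a ∈ X)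
    (hfin : (E.out a).Finite) :
    ∑ e ∈ hfin.toFinset, F.edgeExt e * F.ghostExt e = F.vertexExt a := by
  have hfin' : ((E.restrict X).out ⟨a, h⟩).Finite :=
    Set.Finite.subset (hfin.preimage Subtype.val_injective.injOn)
      fun e he => congrArg Subtype.val he
  rw [F.vertexExt_of_mem h, ← F.sum_edge_mul_ghost ⟨a, h⟩ ha hfin']
  symm
  refine Finset.sum_bij (fun e _ => e.1) ?_ (fun _ _ _ _ h => Subtype.ext h) ?_ ?_
  · intro e he
    rw [Set.Finite.mem_toFinset] at he ⊢
    exact congrArg Subtype.val he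
  · intro e he
    rw [Set.Finite.mem_toFinset] at he
    have hs : E.src e ∈ X := by rw [show E.src e = a from he]; exact h
    exact ⟨⟨e, hs, hX.rng_mem hs⟩, hfin'.mem_toFinset.2 (Subtype.ext he), rfl⟩
  · intro e _
    rw [F.edgeExt_of_mem e.2, F.ghostExt_of_mem e.2]

open Classical in
/-- The weight of a list of edges `p` at a vertex `a`: the final vertex of `p`, as an element of
`A`, if `p` is a path from `a` that meets `X` precisely in its final vertex, and `0` otherwise. -/
noncomputable def weight : E₀ → List E₁ → A
  | a, [] => F.vertexExt a
  | a, e :: p => if a ∉ X ∧ E.src e = a then weight (E.rng e) p else 0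

theorem weight_nil (a : E₀) : F.weight a [] = F.vertexExt a := rfl

open Classical in
theorem weight_cons (a : E₀) (e : E₁) (p : List E₁) :
    F.weight a (e :: p) = if a ∉ X ∧ E.src e = a then F.weight (E.rng e) p else 0 := rfl

theorem weight_cons_of_mem {a : E₀} (h : a ∈ X) (e : E₁) (p : List E₁) :
    F.weight a (e :: p) = 0 := if_neg fun h' => h'.1 h

theorem weight_cons_of_ne {a : E₀} {e : E₁} (h : E.src e ≠ a) (p : List E₁) :
    F.weight a (e :: p) = 0 := if_neg fun h' => h h'.2

theorem weight_cons_src {e : E₁} (h : E.src e ∉ X) (p : List E₁) :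
    F.weight (E.src e) (e :: p) = F.weight (E.rng e) p := if_pos ⟨h, rfl⟩

theorem weight_mul_self (a : E₀) (p : List E₁) :
    F.weight a p * F.weight a p = F.weight a p := by
  induction p generalizing a with
  | nil => exact F.vertexExt_mul_self a
  | cons e p ih =>
    rw [weight_cons]
    split_ifs
    · exact ih _
    · exact mul_zero _

theorem commute_weight (c : R) (a : E₀) (p : List E₁) :
    Commute (F.coeff c) (F.weight a p) := by
  induction p generalizing a with
  | nil => exact F.commute_vertexExt c a
  | cons e p ih =>
    rw [weight_cons]
    split_ifs
    · exact ih _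
    · exact Commute.zero_right _

/-- The action of the coefficients on the functions `E₀ → List E₁ → A`. -/
def coeffOp : R →+* Module.End ℤ (E₀ → List E₁ → A) where
  toFun c :=
    { toFun := fun f b p => F.coeff c * f b p
      map_add' := fun f g => by ext; simp [mul_add]
      map_smul' := fun n f => by ext; simp [-zsmul_eq_mul] }
  map_one' := by
    ext f b p
    change F.coeff 1 * f b p = f b p
    rw [map_one, one_mul]
  map_mul' c d := by
    ext f b p
    change F.coeff (c * d) * f b p = F.coeff c * (F.coeff d * f b p)
    rw [map_mul, mul_assoc]
  map_zero' := by
    ext f b p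
    change F.coeff 0 * f b p = 0
    rw [map_zero, zero_mul]
  map_add' c d := by
    ext f b p
    change F.coeff (c + d) * f b p = F.coeff c * f b p + F.coeff d * f b p
    rw [map_add, add_mul]

open Classical in
/-- The action of a vertex on the functions `E₀ → List E₁ → A`. -/
noncomputable def vertexOp (a : E₀) : Module.End ℤ (E₀ → List E₁ → A) where
  toFun f b p := if b = a then F.weight a p * f a p else 0
  map_add' f g := by ext; dsimp; split_ifs <;> simp [mul_add]
  map_smul' n f := by ext; simp [-zsmul_eq_mul]

open Classical in
/-- The action of an edge on the functions `E₀ → List E₁ → A`. -/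
noncomputable def edgeOp (e : E₁) : Module.End ℤ (E₀ → List E₁ → A) where
  toFun f b p := if b = E.src e then
      (match p with
        | [] => F.edgeExt e * f (E.rng e) []
        | e' :: p => if e' = e then F.weight (E.src e) (e :: p) * f (E.rng e) p else 0)
    else 0
  map_add' f g := by ext b p; cases p <;> dsimp <;> split_ifs <;> simp [mul_add]
  map_smul' n f := by ext b p; cases p <;> simp [-zsmul_eq_mul]

open Classical in
/-- The action of a ghost edge on the functions `E₀ → List E₁ → A`. -/
noncomputable def ghostOp (e : E₁) : Module.End ℤ (E₀ → List E₁ → A) where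
  toFun f b p := if b = E.rng e then
      F.weight (E.src e) (e :: p) * f (E.src e) (e :: p) +
        (if p = [] then F.ghostExt e * f (E.src e) [] else 0)
    else 0
  map_add' f g := by
    ext b p
    dsimp
    split_ifs <;> simp only [mul_add, add_zero]
    abel
  map_smul' n f := by ext; simp [-zsmul_eq_mul]

theorem coeffOp_apply (c : R) (f : E₀ → List E₁ → A) (b : E₀) (p : List E₁) :
    F.coeffOp c f b p = F.coeff c * f b p := rfl

open Classical in
theorem vertexOp_apply (a : E₀) (f : E₀ → List E₁ → A) (b : E₀) (p : List E₁) :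
    F.vertexOp a f b p = if b = a then F.weight a p * f a p else 0 := rfl

open Classical in
theorem edgeOp_apply_nil (e : E₁) (f : E₀ → List E₁ → A) (b : E₀) :
    F.edgeOp e f b [] = if b = E.src e then F.edgeExt e * f (E.rng e) [] else 0 := rfl

open Classical in
theorem edgeOp_apply_cons (e : E₁) (f : E₀ → List E₁ → A) (b : E₀) (e' : E₁) (p : List E₁) :
    F.edgeOp e f b (e' :: p) = if b = E.src e then
      (if e' = e then F.weight (E.src e) (e :: p) * f (E.rng e) p else 0) else 0 := rfl

open Classical in
theorem ghostOp_apply (e : E₁) (f : E₀ → List E₁ → A) (b : E₀) (p : List E₁) :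
    F.ghostOp e f b p = if b = E.rng e then
      F.weight (E.src e) (e :: p) * f (E.src e) (e :: p) +
        (if p = [] then F.ghostExt e * f (E.src e) [] else 0) else 0 := rfl

theorem weight_cons_src_mul_weight (e : E₁) (p : List E₁) :
    F.weight (E.src e) (e :: p) * F.weight (E.rng e) p = F.weight (E.src e) (e :: p) := by
  rw [weight_cons]
  split_ifs
  · exact F.weight_mul_self _ _
  · exact zero_mul _

theorem weight_mul_weight_cons_src (e : E₁) (p : List E₁) :
    F.weight (E.rng e) p * F.weight (E.src e) (e :: p) = F.weight (E.src e) (e :: p) := by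
  rw [weight_cons]
  split_ifs
  · exact F.weight_mul_self _ _
  · exact mul_zero _

/-- One factor vanishes if `s(e)` is in `X`, the other if it is not. Together with the next lemma,
this removes the cross terms between the coefficient action and the path action. -/
theorem edgeExt_mul_weight_cons (e : E₁) (p : List E₁) :
    F.edgeExt e * F.weight (E.src e) (e :: p) = 0 := by
  by_cases h : E.src e ∈ X
  · rw [F.weight_cons_of_mem h, mul_zero]
  · rw [F.edgeExt_of_notMem h, zero_mul]

theorem weight_cons_mul_ghostExt (e : E₁) (p : List E₁) :
    F.weight (E.src e) (e :: p) * F.ghostExt e = 0 := by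
  by_cases h : E.src e ∈ X
  · rw [F.weight_cons_of_mem h, zero_mul]
  · rw [F.ghostExt_of_notMem h, mul_zero]

/-- A family for the restriction `E_X` to a hereditary set, with values in `A`, extends to a family
for `E` that acts on the functions on the paths which meet `X` precisely in their final vertex. -/
noncomputable def extend (hX : E.IsHereditary X) :
    LeavittFamily R E V (Module.End ℤ (E₀ → List E₁ → A)) where
  coeff := F.coeffOp
  vertex := F.vertexOp
  edge := F.edgeOp
  ghost := F.ghostOp
  commute_vertex c a := by
    ext f b p
    simp only [Module.End.mul_apply, coeffOp_apply, vertexOp_apply, mul_ite, mul_zero]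
    congr 1
    rw [← mul_assoc, ← mul_assoc, (F.commute_weight c a p).eq]
  commute_edge c e := by
    ext f b p
    cases p with
    | nil =>
      simp only [Module.End.mul_apply, coeffOp_apply, edgeOp_apply_nil, mul_ite, mul_zero]
      rw [← mul_assoc, ← mul_assoc, (F.commute_edgeExt c e).eq]
    | cons e' p =>
      simp only [Module.End.mul_apply, coeffOp_apply, edgeOp_apply_cons, mul_ite, mul_zero]
      rw [← mul_assoc, ← mul_assoc, (F.commute_weight c _ _).eq]
  commute_ghost c e := by
    ext f b p
    simp only [Module.End.mul_apply, coeffOp_apply, ghostOp_apply, mul_ite, mul_zero, mul_add]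
    simp only [← mul_assoc, (F.commute_weight c _ _).eq, (F.commute_ghostExt c _).eq]
  vertex_mul_self a := by
    ext f b p
    simp only [Module.End.mul_apply, vertexOp_apply, if_true]
    rw [← mul_assoc, F.weight_mul_self]
  vertex_mul_of_ne a b h := by
    ext f c p
    simp [Module.End.mul_apply, vertexOp_apply, h]
  src_mul_edge e := by
    ext f b p
    cases p with
    | nil =>
      simp only [Module.End.mul_apply, vertexOp_apply, edgeOp_apply_nil, if_true, weight_nil]
      rw [← mul_assoc, F.src_mul_edgeExt]
    | cons e' p =>
      simp only [Module.End.mul_apply, vertexOp_apply, edgeOp_apply_cons, if_true, mul_ite,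
        mul_zero]
      by_cases h : e' = e
      · rw [h, ← mul_assoc, F.weight_mul_self]
      · simp [h]
  edge_mul_rng e := by
    ext f b p
    cases p with
    | nil =>
      simp only [Module.End.mul_apply, vertexOp_apply, edgeOp_apply_nil, if_true, weight_nil]
      rw [← mul_assoc, F.edgeExt_mul_rng]
    | cons e' p =>
      simp only [Module.End.mul_apply, vertexOp_apply, edgeOp_apply_cons, if_true]
      rw [← mul_assoc, F.weight_cons_src_mul_weight]
  rng_mul_ghost e := by
    ext f b p
    simp only [Module.End.mul_apply, vertexOp_apply, ghostOp_apply, if_true, mul_add, mul_ite,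
      mul_zero]
    simp only [← mul_assoc, F.weight_mul_weight_cons_src]
    by_cases h : p = []
    · simp only [h, weight_nil, F.rng_mul_ghostExt]
    · simp only [h, if_false]
  ghost_mul_src e := by
    ext f b p
    simp only [Module.End.mul_apply, vertexOp_apply, ghostOp_apply, if_true, ← mul_assoc,
      F.weight_mul_self, weight_nil, F.ghostExt_mul_src]
  ghost_mul_edge e := by
    ext f b p
    simp only [Module.End.mul_apply, vertexOp_apply, ghostOp_apply, edgeOp_apply_nil,
      edgeOp_apply_cons, if_true, ← mul_assoc, F.weight_mul_self]
    by_cases hb : b = E.rng e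
    · simp only [hb, if_true]
      -- If `s(e)` is in `X`, only the coefficient action at the empty list survives; otherwise the
      -- ghost edge deletes the edge just prepended.
      by_cases h : E.src e ∈ X
      · rw [F.weight_cons_of_mem h, zero_mul, zero_add, F.ghostExt_mul_edgeExt hX h]
        cases p with
        | nil => simp [weight_nil]
        | cons e' p => simp [F.weight_cons_of_mem (hX.rng_mem h)]
      · rw [F.weight_cons_src h, F.ghostExt_of_notMem h]
        simp
    · simp only [hb, if_false]
  ghost_mul_edge_of_ne e e' h := by
    ext f b p
    simp only [Module.End.mul_apply, ghostOp_apply, edgeOp_apply_nil, edgeOp_apply_cons, mul_ite,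
      ← mul_assoc, F.ghostExt_mul_edgeExt_of_ne h, h, if_false]
    simp
  sum_edge_mul_ghost a ha hfin := by
    ext f b p
    rw [LinearMap.sum_apply, Finset.sum_apply, Finset.sum_apply]
    simp only [Module.End.mul_apply]
    rw [vertexOp_apply]
    by_cases hb : b = a
    · subst hb
      rw [if_pos rfl]
      cases p with
      | nil =>
        have key : ∀ e ∈ hfin.toFinset, F.edgeOp e (F.ghostOp e f) b [] =
            F.edgeExt e * F.ghostExt e * f b [] := by
          intro e he
          have he : E.src e = b := hfin.mem_toFinset.1 he
          rw [edgeOp_apply_nil, if_pos he.symm, ghostOp_apply, if_pos rfl, if_pos rfl, mul_add,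
            ← mul_assoc, F.edgeExt_mul_weight_cons, zero_mul, zero_add, ← mul_assoc, he]
        rw [Finset.sum_congr rfl key, ← Finset.sum_mul, weight_nil]
        -- At the empty list this is the relation of `E_X` if `b` is in `X`; otherwise both sides
        -- vanish.
        by_cases hbX : b ∈ X
        · rw [F.sum_edgeExt_mul_ghostExt hX ha hbX]
        · rw [F.vertexExt_of_notMem hbX, Finset.sum_eq_zero]
          intro e he
          have he : E.src e = b := hfin.mem_toFinset.1 he
          rw [F.edgeExt_of_notMem (he ▸ hbX), zero_mul]
      | cons e' p =>
        -- At a nonempty list only its first edge `e'` can contribute to the sum.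
        by_cases he' : E.src e' = b
        · rw [Finset.sum_eq_single e']
          · subst he'
            rw [edgeOp_apply_cons, if_pos rfl, if_pos rfl, ghostOp_apply, if_pos rfl, mul_add,
              ← mul_assoc, F.weight_mul_self, mul_ite, ← mul_assoc, F.weight_cons_mul_ghostExt]
            simp
          · intro e _ h
            rw [edgeOp_apply_cons, if_neg (Ne.symm h), ite_self]
          · intro h
            exact (h (hfin.mem_toFinset.2 he')).elim
        · rw [F.weight_cons_of_ne he', zero_mul, Finset.sum_eq_zero]
          intro e he
          have he : E.src e = b := hfin.mem_toFinset.1 he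
          rw [edgeOp_apply_cons, if_neg (c := e' = e) (by rintro rfl; exact he' he), ite_self]
    · rw [if_neg hb, Finset.sum_eq_zero]
      intro e he
      have he : E.src e = a := hfin.mem_toFinset.1 he
      cases p with
      | nil => rw [edgeOp_apply_nil, if_neg (he ▸ hb)]
      | cons e' p => rw [edgeOp_apply_cons, if_neg (he ▸ hb)]

end Extension

end LeavittFamily

variable {X : Set E₀}

namespace LeavittFamily

/-! ### Evaluation at paths of length zero, and injectivity -/

section Evaluation

variable {A : Type*} [Ring A] (F : LeavittFamily R (E.restrict X) (Subtype.val ⁻¹' V) A)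

theorem finsum_vertexExt_coe : ∑ᶠ x : X, F.vertexExt x.1 = ∑ᶠ x, F.vertex x :=
  finsum_congr fun x => F.vertexExt_of_mem x.2

theorem finsum_vertexExt : ∑ᶠ a, F.vertexExt a = ∑ᶠ x, F.vertex x := by
  rw [← finsum_vertexExt_coe]
  refine Eq.trans ?_ (finsum_subtype_eq_finsum_cond (· ∈ X)).symm
  refine finsum_congr fun a => ?_
  by_cases h : a ∈ X
  · simp [h]
  · simp [h, F.vertexExt_of_notMem h]

variable [Finite E₀]

/-- The total value of a function `E₀ → List E₁ → A` at the paths of length `0` in `X`. -/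
noncomputable def eval : (E₀ → List E₁ → A) →+ A where
  toFun f := ∑ᶠ a, F.vertexExt a * f a []
  map_zero' := by simp
  map_add' f g := by
    rw [← finsum_add_distrib (Set.toFinite _) (Set.toFinite _)]
    exact finsum_congr fun a => mul_add _ _ _

theorem eval_apply (f : E₀ → List E₁ → A) : F.eval f = ∑ᶠ a, F.vertexExt a * f a [] := rfl

theorem vertexExt_mul_eval (a : E₀) (f : E₀ → List E₁ → A) :
    F.vertexExt a * F.eval f = F.vertexExt a * f a [] := by
  rw [eval_apply, mul_finsum' _ _ (Set.toFinite _), finsum_eq_single _ a, ← mul_assoc,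
    F.vertexExt_mul_self]
  intro b hb
  rw [← mul_assoc, F.vertexExt_mul_of_ne hb.symm, zero_mul]

theorem eval_coeffOp (c : R) (f : E₀ → List E₁ → A) :
    F.eval (F.coeffOp c f) = F.coeff c * F.eval f := by
  rw [eval_apply, eval_apply, mul_finsum' _ _ (Set.toFinite _)]
  refine finsum_congr fun a => ?_
  rw [coeffOp_apply, ← mul_assoc, ← mul_assoc, (F.commute_vertexExt c a).eq]

theorem eval_vertexOp (a : E₀) (f : E₀ → List E₁ → A) :
    F.eval (F.vertexOp a f) = F.vertexExt a * F.eval f := by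
  rw [vertexExt_mul_eval, eval_apply, finsum_eq_single _ a]
  · rw [vertexOp_apply, if_pos rfl, weight_nil, ← mul_assoc, F.vertexExt_mul_self]
  · intro b hb
    rw [vertexOp_apply, if_neg hb, mul_zero]

theorem eval_edgeOp (e : E₁) (f : E₀ → List E₁ → A) :
    F.eval (F.edgeOp e f) = F.edgeExt e * F.eval f := by
  rw [← F.edgeExt_mul_rng, mul_assoc, vertexExt_mul_eval, ← mul_assoc, F.edgeExt_mul_rng,
    eval_apply, finsum_eq_single _ (E.src e)]
  · rw [edgeOp_apply_nil, if_pos rfl, ← mul_assoc, F.src_mul_edgeExt]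
  · intro b hb
    rw [edgeOp_apply_nil, if_neg hb, mul_zero]

/-- For a source outside `X`, the value of `f` at the one-edge path `e` would enter; a source in `X`
gives this path weight `0`. -/
theorem eval_ghostOp {e : E₁} (h : E.src e ∈ X) (f : E₀ → List E₁ → A) :
    F.eval (F.ghostOp e f) = F.ghostExt e * F.eval f := by
  rw [← F.ghostExt_mul_src, mul_assoc, vertexExt_mul_eval, ← mul_assoc, F.ghostExt_mul_src,
    eval_apply, finsum_eq_single _ (E.rng e)]
  · rw [ghostOp_apply, if_pos rfl, if_pos rfl, F.weight_cons_of_mem h, zero_mul, zero_add,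
      ← mul_assoc, F.rng_mul_ghostExt]
  · intro b hb
    rw [ghostOp_apply, if_neg hb, mul_zero]

theorem eval_finsum_vertexOp {ι : Type*} [Finite ι] (g : ι → E₀) (f : E₀ → List E₁ → A) :
    F.eval ((∑ᶠ i, F.vertexOp (g i)) f) = (∑ᶠ i, F.vertexExt (g i)) * F.eval f := by
  cases nonempty_fintype ι
  rw [finsum_eq_sum_of_fintype, finsum_eq_sum_of_fintype, LinearMap.sum_apply, map_sum,
    Finset.sum_mul]
  exact Finset.sum_congr rfl fun i _ => F.eval_vertexOp _ _

end Evaluation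

variable [Finite E₀]

variable (R V) in
/-- The homomorphism from the ring of `E_X` to the corner of the ring of `E`. -/
noncomputable def cornerHom (hX : E.IsHereditary X) :
    RelLeavittPathRing R (E.restrict X) (Subtype.val ⁻¹' V) →+*
      ((universal R E V).restrict hX).isIdempotentElem_finsum.Corner :=
  ((universal R E V).restrict hX).lift

/-- Evaluation intertwines the action of `E_X` through the ring of `E` with left multiplication on
`A`. For the universal family this reads `z` off from its image. -/
theorem eval_lift_extend {A : Type*} [Ring A]
    (F : LeavittFamily R (E.restrict X) (Subtype.val ⁻¹' V) A) (hF : ∑ᶠ x, F.vertex x = 1)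
    (hX : E.IsHereditary X) (z : RelLeavittPathRing R (E.restrict X) (Subtype.val ⁻¹' V))
    (f : E₀ → List E₁ → A) :
    F.eval (((F.extend hX).lift (cornerHom R V hX z).1).1 f) = (F.lift z).1 * F.eval f := by
  induction z using RelLeavittPathRing.induction generalizing f with
  | coeff c =>
    have h1 : ((F.extend hX).lift (cornerHom R V hX (RelLeavittPathRing.coeff _ _ _ c)).1).1 =
        F.coeffOp c * (∑ᶠ a, F.vertexOp a) * ∑ᶠ x : X, F.vertexOp x.1 := by
      rw [cornerHom, lift_coeff]
      have h2 : ((F.extend hX).lift (∑ᶠ x, ((universal R E V).restrict hX).vertex x)).1 =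
          ∑ᶠ x : X, F.vertexOp x.1 := by
        rw [← cornerVal_apply, map_finsum _ (Set.toFinite _),
          ← NonUnitalRingHom.coe_toAddMonoidHom, map_finsum _ (Set.toFinite _)]
        exact finsum_congr fun x => (F.extend hX).lift_vertex x.1
      rw [map_mul]
      change ((F.extend hX).lift (RelLeavittPathRing.coeff R E V c)).1 * _ = _
      rw [h2, lift_coeff]
      rfl
    rw [h1, Module.End.mul_apply, Module.End.mul_apply, eval_coeffOp,
      F.eval_finsum_vertexOp fun a => a, eval_finsum_vertexOp, finsum_vertexExt_coe,
      finsum_vertexExt, lift_coeff, hF, one_mul, one_mul, mul_one]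
  | vertex x =>
    rw [cornerHom, lift_vertex, lift_vertex]
    change F.eval (((F.extend hX).lift (RelLeavittPathRing.vertex R E V x.1)).1 f) = _
    rw [lift_vertex, ← F.vertexExt_of_mem x.2]
    exact F.eval_vertexOp x.1 f
  | edge e =>
    rw [cornerHom, lift_edge, lift_edge]
    change F.eval (((F.extend hX).lift (RelLeavittPathRing.edge R E V e.1)).1 f) = _
    rw [lift_edge, ← F.edgeExt_of_mem e.2]
    exact F.eval_edgeOp e.1 f
  | ghost e =>
    rw [cornerHom, lift_ghost, lift_ghost]
    change F.eval (((F.extend hX).lift (RelLeavittPathRing.ghost R E V e.1)).1 f) = _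
    rw [lift_ghost, ← F.ghostExt_of_mem e.2]
    exact F.eval_ghostOp e.2.1 f
  | add y z hy hz =>
    have h1 : ((F.extend hX).lift (cornerHom R V hX (y + z)).1).1 =
        ((F.extend hX).lift (cornerHom R V hX y).1).1 +
          ((F.extend hX).lift (cornerHom R V hX z).1).1 := by
      simp only [← cornerVal_apply, map_add]
    have h2 : (F.lift (y + z)).1 = (F.lift y).1 + (F.lift z).1 := by
      simp only [← cornerVal_apply, map_add]
    rw [h1, h2, LinearMap.add_apply, map_add, hy, hz, add_mul]
  | mul y z hy hz =>
    have h1 : ((F.extend hX).lift (cornerHom R V hX (y * z)).1).1 =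
        ((F.extend hX).lift (cornerHom R V hX y).1).1 *
          ((F.extend hX).lift (cornerHom R V hX z).1).1 := by
      simp only [← cornerVal_apply, map_mul]
    have h2 : (F.lift (y * z)).1 = (F.lift y).1 * (F.lift z).1 := by
      simp only [← cornerVal_apply, map_mul]
    rw [h1, h2, Module.End.mul_apply, hy, hz, mul_assoc]

theorem lift_universal (z : RelLeavittPathRing R E V) : ((universal R E V).lift z).1 = z := by
  induction z using RelLeavittPathRing.induction with
  | coeff c =>
    rw [lift_coeff]
    change _ * (∑ᶠ a, RelLeavittPathRing.vertex R E V a) = _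
    rw [RelLeavittPathRing.finsum_vertex, mul_one]
    rfl
  | vertex a => exact lift_vertex _ a
  | edge e => exact lift_edge _ e
  | ghost e => exact lift_ghost _ e
  | add y z hy hz =>
    conv_rhs => rw [← hy, ← hz]
    simp only [← cornerVal_apply, map_add]
  | mul y z hy hz =>
    conv_rhs => rw [← hy, ← hz]
    simp only [← cornerVal_apply, map_mul]

theorem cornerHom_injective (hX : E.IsHereditary X) :
    Function.Injective (cornerHom R V hX) := by
  rw [injective_iff_map_eq_zero]
  intro z hz
  have hF := RelLeavittPathRing.finsum_vertex R (E.restrict X) (Subtype.val ⁻¹' V)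
  let F := universal R (E.restrict X) (Subtype.val ⁻¹' V)
  -- This test function evaluates to the sum of the vertices of `E_X`, which is `1`, so the right
  -- side is `z` itself.
  have h := eval_lift_extend F hF hX z fun a _ => F.vertexExt a
  have h0 : F.eval (fun a _ => F.vertexExt a) = 1 := by
    rw [eval_apply, finsum_congr F.vertexExt_mul_self, finsum_vertexExt]
    exact hF
  have h1 : ((F.extend hX).lift (cornerHom R V hX z).1).1 = 0 := by
    simp only [← cornerVal_apply, hz, map_zero]
  rw [h0, mul_one, h1, LinearMap.zero_apply, map_zero, lift_universal] at h
  exact h.symm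

end LeavittFamily

/-! ### Surjectivity onto the corner, and fullness -/

namespace RelLeavittPathRing

open LeavittPath.LeavittFamily (universal cornerHom cornerHom_injective lift_vertex lift_edge lift_ghost
  lift_coeff)

/-- The elements of `S` that are sums of products `e₁ ⋯ eₙ z` with `z` in a given set `Z` and edges
`eᵢ` whose sources do not lie in `X`. -/
inductive PathSpan {S : Type*} [Ring S] (F : LeavittFamily R E V S) (X : Set E₀) (Z : Set S) :
    S → Prop
  | mem (z : S) (hz : z ∈ Z) : PathSpan F X Z z
  | edge_mul (e : E₁) (he : E.src e ∉ X) (z : S) (hz : PathSpan F X Z z) :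
      PathSpan F X Z (F.edge e * z)
  | add (y z : S) (hy : PathSpan F X Z y) (hz : PathSpan F X Z z) : PathSpan F X Z (y + z)

theorem PathSpan.zero {Z : NonUnitalSubring (RelLeavittPathRing R E V)} :
    PathSpan (universal R E V) X (Z : Set (RelLeavittPathRing R E V)) 0 :=
  .mem 0 Z.zero_mem

variable [Finite E₀]

variable (R V) in
/-- The inclusion of the ring of `E_X` in the ring of `E`. -/
noncomputable def cornerInclusion (hX : E.IsHereditary X) :
    RelLeavittPathRing R (E.restrict X) (Subtype.val ⁻¹' V) →ₙ+* RelLeavittPathRing R E V :=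
  (cornerVal _).comp (RingHom.toNonUnitalRingHom (cornerHom R V hX))

section Surjectivity

variable (hX : E.IsHereditary X)

variable (R V) in
/-- The image of the ring of `E_X` in the ring of `E`. -/
noncomputable def cornerRange : NonUnitalSubring (RelLeavittPathRing R E V) :=
  NonUnitalRingHom.range (cornerInclusion R V hX)

theorem vertex_mem_cornerRange {a : E₀} (ha : a ∈ X) : vertex R E V a ∈ cornerRange R V hX :=
  ⟨vertex R _ _ ⟨a, ha⟩, lift_vertex _ _⟩

theorem edge_mem_cornerRange {e : E₁} (he : E.src e ∈ X) : edge R E V e ∈ cornerRange R V hX :=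
  ⟨edge R _ _ ⟨e, he, hX.rng_mem he⟩, lift_edge _ _⟩

theorem ghost_mem_cornerRange {e : E₁} (he : E.src e ∈ X) : ghost R E V e ∈ cornerRange R V hX :=
  ⟨ghost R _ _ ⟨e, he, hX.rng_mem he⟩, lift_ghost _ _⟩

theorem finsum_mul_of_mem_cornerRange {z : RelLeavittPathRing R E V}
    (hz : z ∈ cornerRange R V hX) : (∑ᶠ x : X, vertex R E V x) * z = z := by
  obtain ⟨a, rfl⟩ := hz
  exact ((Subsemigroup.mem_corner_iff
    ((universal R E V).restrict hX).isIdempotentElem_finsum).1 (cornerHom R V hX a).2).1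

theorem finsum_mem_cornerRange : (∑ᶠ x : X, vertex R E V x) ∈ cornerRange R V hX :=
  ⟨1, congrArg Subtype.val (map_one (cornerHom R V hX))⟩

theorem coeff_mul_mem_cornerRange (c : R) {z : RelLeavittPathRing R E V}
    (hz : z ∈ cornerRange R V hX) : coeff R E V c * z ∈ cornerRange R V hX := by
  rw [← finsum_mul_of_mem_cornerRange hX hz, ← mul_assoc]
  exact mul_mem ⟨coeff R _ _ c, lift_coeff _ _⟩ hz

theorem mul_finsum_of_notMem {z : RelLeavittPathRing R E V} {a : E₀} (ha : a ∉ X)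
    (hz : z * vertex R E V a = z) : z * (∑ᶠ x : X, vertex R E V x) = 0 := by
  rw [← hz, mul_finsum' _ _ (Set.toFinite _)]
  refine finsum_eq_zero_of_forall_eq_zero fun x => ?_
  rw [mul_assoc]
  exact (congrArg _ ((universal R E V).vertex_mul_of_ne a x fun h => ha (h ▸ x.2))).trans
    (mul_zero _)

theorem finsum_mul_of_notMem {z : RelLeavittPathRing R E V} {a : E₀} (ha : a ∉ X)
    (hz : vertex R E V a * z = z) : (∑ᶠ x : X, vertex R E V x) * z = 0 := by
  rw [← hz, finsum_mul' _ _ (Set.toFinite _)]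
  refine finsum_eq_zero_of_forall_eq_zero fun x => ?_
  rw [← mul_assoc]
  exact (congrArg (· * z) ((universal R E V).vertex_mul_of_ne x a fun h => ha (h ▸ x.2))).trans
    (zero_mul _)

variable {hX} in
theorem mul_eq_zero_of_mem_cornerRange {y z : RelLeavittPathRing R E V} {a : E₀} (ha : a ∉ X)
    (hy : y * vertex R E V a = y) (hz : z ∈ cornerRange R V hX) : y * z = 0 := by
  rw [← finsum_mul_of_mem_cornerRange hX hz, ← mul_assoc, mul_finsum_of_notMem ha hy, zero_mul]

theorem PathSpan.vertex_mul {z : RelLeavittPathRing R E V}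
    (hz : PathSpan (universal R E V) X (cornerRange R V hX) z) (a : E₀) :
    PathSpan (universal R E V) X (cornerRange R V hX) (vertex R E V a * z) := by
  induction hz with
  | mem z hz =>
    by_cases ha : a ∈ X
    · exact .mem _ (mul_mem (vertex_mem_cornerRange hX ha) hz)
    · rw [show vertex R E V a * z = 0 from
        mul_eq_zero_of_mem_cornerRange ha ((universal R E V).vertex_mul_self a) hz]
      exact .zero
  | edge_mul e he z hz =>
    rw [← mul_assoc]
    by_cases h : a = E.src e
    · rw [h, show vertex R E V (E.src e) * (universal R E V).edge e = (universal R E V).edge e from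
        (universal R E V).src_mul_edge e]
      exact .edge_mul e he z hz
    · rw [← (universal R E V).src_mul_edge e, ← mul_assoc,
        show vertex R E V a * (universal R E V).vertex (E.src e) = 0 from
          (universal R E V).vertex_mul_of_ne _ _ h, zero_mul, zero_mul]
      exact .zero
  | add y z _ _ hy hz =>
    rw [mul_add]
    exact .add _ _ hy hz

/-- It suffices to multiply by generators. An edge from outside `X` lengthens the paths; a ghost
edge cancels the first edge of a path or kills the term, and on the image of `A` it stays in the
image or gives `0`. -/
theorem PathSpan.mul_left (y : RelLeavittPathRing R E V) {z : RelLeavittPathRing R E V}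
    (hz : PathSpan (universal R E V) X (cornerRange R V hX) z) :
    PathSpan (universal R E V) X (cornerRange R V hX) (y * z) := by
  induction y using RelLeavittPathRing.induction generalizing z with
  | coeff c =>
    induction hz with
    | mem z hz => exact .mem _ (coeff_mul_mem_cornerRange hX c hz)
    | edge_mul e he z _ hz =>
      rw [← mul_assoc, show coeff R E V c * (universal R E V).edge e = _ from
        (universal R E V).commute_edge c e, mul_assoc]
      exact .edge_mul e he _ hz
    | add y z _ _ hy hz =>
      rw [mul_add]
      exact .add _ _ hy hz
  | vertex a => exact hz.vertex_mul hX a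
  | edge e =>
    by_cases he : E.src e ∈ X
    · induction hz with
      | mem z hz => exact .mem _ (mul_mem (edge_mem_cornerRange hX he) hz)
      | edge_mul f hf z hz =>
        -- Heredity puts `r(e)` in `X`, whereas `s(f)` is outside `X`, so `e` and `f` are not
        -- composable.
        have : edge R E V e * (universal R E V).edge f = 0 := by
          rw [← (universal R E V).src_mul_edge f, ← (show _ = edge R E V e from
            (universal R E V).edge_mul_rng e), mul_assoc,
            ← mul_assoc ((universal R E V).vertex (E.rng e)),
            (universal R E V).vertex_mul_of_ne, zero_mul, mul_zero]
          intro h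
          exact hf (h ▸ hX.rng_mem he)
        rw [← mul_assoc, this, zero_mul]
        exact .zero
      | add y z _ _ hy hz =>
        rw [mul_add]
        exact .add _ _ hy hz
    · exact .edge_mul e he z hz
  | ghost e =>
    induction hz with
    | mem z hz =>
      by_cases he : E.src e ∈ X
      · exact .mem _ (mul_mem (ghost_mem_cornerRange hX he) hz)
      · rw [show ghost R E V e * z = 0 from
          mul_eq_zero_of_mem_cornerRange he ((universal R E V).ghost_mul_src e) hz]
        exact .zero
    | edge_mul f hf z hz =>
      rw [← mul_assoc]
      by_cases h : e = f
      · rw [← h, show ghost R E V e * (universal R E V).edge e = vertex R E V (E.rng e) from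
          (universal R E V).ghost_mul_edge e]
        exact hz.vertex_mul hX _
      · rw [show ghost R E V e * (universal R E V).edge f = 0 from
          (universal R E V).ghost_mul_edge_of_ne e f h, zero_mul]
        exact .zero
    | add y z _ _ hy hz =>
      rw [mul_add]
      exact .add _ _ hy hz
  | add x y hx hy =>
    rw [add_mul]
    exact .add _ _ (hx hz) (hy hz)
  | mul x y hx hy =>
    rw [mul_assoc]
    exact hx (hy hz)

theorem PathSpan.finsum_mul_mem {z : RelLeavittPathRing R E V}
    (hz : PathSpan (universal R E V) X (cornerRange R V hX) z) :
    (∑ᶠ x : X, vertex R E V x) * z ∈ cornerRange R V hX := by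
  induction hz with
  | mem z hz => exact mul_mem (finsum_mem_cornerRange hX) hz
  | edge_mul e he z _ _ =>
    rw [← mul_assoc, finsum_mul_of_notMem he ((universal R E V).src_mul_edge e), zero_mul]
    exact zero_mem _
  | add y z _ _ hy hz =>
    rw [mul_add]
    exact add_mem hy hz

/-- By `PathSpan.mul_left`, `zε` is a sum of paths from outside `X` times elements of the image;
left multiplication by `ε` leaves only the terms without edges. -/
theorem finsum_mul_mul_finsum_mem_cornerRange (z : RelLeavittPathRing R E V) :
    (∑ᶠ x : X, vertex R E V x) * z * (∑ᶠ x : X, vertex R E V x) ∈ cornerRange R V hX := by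
  rw [mul_assoc]
  exact ((PathSpan.mem _ (finsum_mem_cornerRange hX)).mul_left hX z).finsum_mul_mem hX

theorem cornerHom_surjective : Function.Surjective (cornerHom R V hX) := by
  intro z
  obtain ⟨a, ha⟩ := finsum_mul_mul_finsum_mem_cornerRange hX z.1
  refine ⟨a, Subtype.ext (ha.trans ?_)⟩
  have hz := (Subsemigroup.mem_corner_iff
    ((universal R E V).restrict hX).isIdempotentElem_finsum).1 z.2
  exact (congrArg (· * _) hz.1).trans hz.2

end Surjectivity

theorem span_finsum_vertex_eq_top (hV : V ⊆ E.Reg) (hcl : E.saturatedClosure V X = Set.univ) :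
    TwoSidedIdeal.span {∑ᶠ x : X, vertex R E V x} = ⊤ := by
  set I := TwoSidedIdeal.span {∑ᶠ x : X, vertex R E V x}
  have hmem : (∑ᶠ x : X, vertex R E V x) ∈ I := TwoSidedIdeal.subset_span rfl
  -- The set on the right contains `X` because `x = xε`. It is `V`-saturated because `a = ∑ e r(e)
  -- e*` for `a` in `V`, a finite sum by regularity.
  have hY : E.saturatedClosure V X ⊆ {a | vertex R E V a ∈ I} := by
    refine Set.sInter_subset_of_mem ⟨fun x hx => ?_, fun a ha h => ?_⟩
    · have : vertex R E V x * (∑ᶠ x : X, vertex R E V x) = vertex R E V x := by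
        rw [mul_finsum' _ _ (Set.toFinite _), finsum_eq_single _ ⟨x, hx⟩]
        · exact (universal R E V).vertex_mul_self x
        · exact fun y hy =>
            (universal R E V).vertex_mul_of_ne _ _ fun h => hy (Subtype.ext h.symm)
      change vertex R E V x ∈ I
      rw [← this]
      exact I.mul_mem_left _ _ hmem
    · change (universal R E V).vertex a ∈ I
      rw [← (universal R E V).sum_edge_mul_ghost a ha (hV ha).2]
      refine I.finsetSum_mem _ _ fun e he => I.mul_mem_right _ _ ?_
      rw [← (universal R E V).edge_mul_rng e]
      exact I.mul_mem_left _ _ (h ⟨e, (hV ha).2.mem_toFinset.1 he, rfl⟩)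
  rw [← TwoSidedIdeal.one_mem_iff, ← finsum_vertex R E V]
  cases nonempty_fintype E₀
  rw [finsum_eq_sum_of_fintype]
  exact I.finsetSum_mem _ _ fun a _ => hY (hcl ▸ Set.mem_univ a)

theorem isFullCorner_cornerInclusion (hV : V ⊆ E.Reg) (hX : E.IsHereditary X)
    (hcl : E.saturatedClosure V X = Set.univ) : IsFullCorner (cornerInclusion R V hX) := by
  have h1 : cornerInclusion R V hX 1 = ∑ᶠ x : X, vertex R E V x :=
    congrArg Subtype.val (map_one (cornerHom R V hX))
  refine ⟨(cornerVal_injective _).comp (cornerHom_injective hX), fun z => ?_, ?_⟩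
  · rw [h1]
    exact finsum_mul_mul_finsum_mem_cornerRange hX z
  · rw [h1]
    refine exists_sum_of_mem_span ?_
    rw [span_finsum_vertex_eq_top hV hcl]
    trivial

end RelLeavittPathRing

end LeavittPath

theorem proposition4p3 {R : Type u} [Ring R] {E₀ : Type v} {E₁ : Type w} [Finite E₀]
    (E : DirectedGraph E₀ E₁) (V : Set E₀) (hV : V ⊆ E.Reg)
    (X : Set E₀) (hX : E.IsHereditary X) (hcl : E.saturatedClosure V X = Set.univ) :
    -- the corner at the sum of the vertices in `X` is full and isomorphic to the ring of `E_X`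
    (∃ (hε : IsIdempotentElem (∑ᶠ x : X, RelLeavittPathRing.vertex R E V x))
        (φ : RelLeavittPathRing R (E.restrict X) (Subtype.val ⁻¹' V) ≃+* hε.Corner),
      TwoSidedIdeal.span {∑ᶠ x : X, RelLeavittPathRing.vertex R E V x} = ⊤ ∧
      (∀ x, (φ (RelLeavittPathRing.vertex R (E.restrict X) (Subtype.val ⁻¹' V) x)).1 =
        RelLeavittPathRing.vertex R E V x.1) ∧
      (∀ e, (φ (RelLeavittPathRing.edge R (E.restrict X) (Subtype.val ⁻¹' V) e)).1 =
        RelLeavittPathRing.edge R E V e.1) ∧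
      (∀ e, (φ (RelLeavittPathRing.ghost R (E.restrict X) (Subtype.val ⁻¹' V) e)).1 =
        RelLeavittPathRing.ghost R E V e.1) ∧
      (∀ c, (φ (RelLeavittPathRing.coeff R (E.restrict X) (Subtype.val ⁻¹' V) c)).1 =
        RelLeavittPathRing.coeff R E V c *
          ∑ᶠ x : X, RelLeavittPathRing.vertex R E V x)) ∧
    -- part (i)
    AreMoritaEquivalent
      (RelLeavittPathRing R (E.restrict X) (Subtype.val ⁻¹' V))
      (RelLeavittPathRing R E V) ∧
    -- part (ii)
    gn (RelLeavittPathRing R E V) ≤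
      gn (RelLeavittPathRing R (E.restrict X) (Subtype.val ⁻¹' V)) ∧
    (gn (RelLeavittPathRing R E V) = ⊤ ∨
        gn (RelLeavittPathRing R (E.restrict X) (Subtype.val ⁻¹' V)) = ⊤ →
      gn (RelLeavittPathRing R E V) =
        gn (RelLeavittPathRing R (E.restrict X) (Subtype.val ⁻¹' V))) := by
  have hj := RelLeavittPathRing.isFullCorner_cornerInclusion (R := R) hV hX hcl
  let e := RingEquiv.ofBijective (LeavittFamily.cornerHom R V hX)
    ⟨LeavittFamily.cornerHom_injective hX, RelLeavittPathRing.cornerHom_surjective hX⟩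
  refine ⟨⟨((LeavittFamily.universal R E V).restrict hX).isIdempotentElem_finsum,
    e, RelLeavittPathRing.span_finsum_vertex_eq_top hV hcl, fun x => ?_, fun e => ?_, fun e => ?_,
    fun c => ?_⟩, hj.areMoritaEquivalent, hj.gn_le, hj.gn_eq⟩
  · exact LeavittFamily.lift_vertex _ x
  · exact LeavittFamily.lift_edge _ e
  · exact LeavittFamily.lift_ghost _ e
  · exact LeavittFamily.lift_coeff _ c
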